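/- Let $k$ be a positive integer or $k=\infty$ (with $\mathbb{N}^\infty$ read as the direct sum $\bigoplus_{i\ge 1}\mathbb{N}$). A $k$-graph is a countable small category $\Lambda$ (identified with its set of morphisms, objects being identified with their identity morphisms; $r$ and $s$ denote range and source) with a degree functor $d:\Lambda\to\mathbb{N}^k$ such that whenever $d(\mu)=m+n$ there are unique $\alpha,\beta\in\Lambda$ with $d(\alpha)=m$, $d(\beta)=n$, $s(\alpha)=r(\beta)$ and $\mu=\alpha\beta$. Write $\Lambda^n=d^{-1}(n)$ and $v\Lambda^n=\{\mu\in\Lambda^n: r(\mu)=v\}$ for $v\in\Lambda^0$. Let $\Lambda$ be a $k$-graph that is row-finite and without sources ($v\Lambda^n$ is finite and nonempty for all $v\in\Lambda^0$, $n\in\mathbb{N}^k$) and such that $\Lambda^0$ is finite. Let $G$ be a discrete countable group with a self-similar action on $\Lambda$: $G$ acts on the set $\Lambda$ by bijections that preserve degrees and commute with $r$ and $s$, and there is a map $G\times\Lambda\to G$, $(g,\mu)\mapsto g|_\mu$, with $$g\cdot(\mu\nu)=(g\cdot\mu)(g|_\mu\cdot\nu),\qquad g|_{\mu\nu}=(g|_\mu)|_\nu\qquad\text{whenever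 } s(\mu)=r(\nu),$$ $g|_v=g$ for $v\in\Lambda^0$, $1_G|_\mu=1_G$, and $(gh)|_\mu=g|_{h\cdot\mu}\,h|_\mu$. A Cuntz--Krieger $\Lambda$-family in a C*-algebra is a family of partial isometries $\{S_\mu\}_{\mu\in\Lambda}$ such that the $S_v$ ($v\in\Lambda^0$) are mutually orthogonal projections, $S_{\mu\nu}=S_\mu S_\nu$ if $s(\mu)=r(\nu)$, $S_\mu^*S_\mu=S_{s(\mu)}$, and $S_v=\sum_{\mu\in v\Lambda^n}S_\mu S_\mu^*$ for all $v\in\Lambda^0$, $n\in\mathbb{N}^k$. Let $\mathcal{O}_{G,\Lambda}$ be the universal unital C*-algebra generated by unitaries $\{u_g\}_{g\in G}$ and a Cuntz--Krieger $\Lambda$-family $\{s_\mu\}_{\mu\in\Lambda}$ with $\sum_{v\in\Lambda^0}s_v=1$, $u_{gh}=u_gu_h$ and $u_gs_\mu=s_{g\cdot\mu}u_{g|_\mu}$ for all $g,h\in G$, $\mu\in\Lambda$. Let $A=C(\Lambda^0)\rtimes G$ be the full crossed product for the action $\delta_v\mapsto\delta_{g\cdot v}$, with canonical generators $j(\delta_v)$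 and $j(g)$. For $p\in\mathbb{N}^k$ let $X_p=\bigoplus_{\mu\in\Lambda^p}j(\delta_{s(\mu)})A$ be the direct sum of right Hilbert $A$-modules, with inner product $\langle x,y\rangle=\sum_\mu x(\mu)^*y(\mu)$, and let $\chi_\mu\in X_p$ be the element with coordinate $j(\delta_{s(\mu)})$ at $\mu$ and $0$ elsewhere; $X_0$ is identified with $A$ by $a\mapsto(j(\delta_v)a)_{v\in\Lambda^0}$. Let $\phi_p:A\to\mathcal{L}(X_p)$ be the left action for which $j(\delta_v)$ acts as the projection onto $\bigoplus_{\mu\in v\Lambda^p}j(\delta_{s(\mu)})A$ and $j(g)\cdot(\chi_\mu a)=\chi_{g\cdot\mu}\,j(g|_\mu)a$. With the multiplication that extends these actions of $X_0=A$ and satisfies $$(\chi_\mu j(g))(\chi_\nu j(h))=\begin{cases}\chi_{\mu(g\cdot\nu)}\,j(g|_\nu h)&\text{if } s(\mu)=r(g\cdot\nu),\\ 0&\text{otherwise,}\end{cases}$$ $X_{G,\Lambda}=\bigsqcup_{p\in\mathbb{N}^k}X_p$ is a product system over $\mathbb{N}^k$ with coefficient algebra $A$ (each $X_p$ is an essential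 C*-correspondence with $\phi_p(A)\subseteq\mathcal{K}(X_p)$, the multiplication is associative and induces isomorphisms $X_p\otimes_AX_q\cong X_{p+q}$). A representation of a product system $X$ in a C*-algebra $B$ is a map $\psi:X\to B$ with linear restrictions $\psi_p=\psi|_{X_p}$ such that $\psi_0$ is a $*$-homomorphism, $\psi_p(a\cdot x)=\psi_0(a)\psi_p(x)$, $\psi_p(x)^*\psi_p(y)=\psi_0(\langle x,y\rangle)$ and $\psi_p(x)\psi_q(y)=\psi_{p+q}(xy)$. It is Cuntz--Pimsner covariant if $\psi_0(a)=\psi_p^{(1)}(\phi_p(a))$ for all $p\in\mathbb{N}^k$, $a\in A$, where $\psi_p^{(1)}:\mathcal{K}(X_p)\to B$ is the $*$-homomorphism with $\psi_p^{(1)}(\Theta_{x,y})=\psi_p(x)\psi_p(y)^*$, $\Theta_{x,y}(z)=x\langle y,z\rangle$. The Cuntz--Pimsner algebra $\mathcal{O}_X$ is the C*-algebra generated by a universal Cuntz--Pimsner covariant representation of $X$. Then $\mathcal{O}_{X_{G,\Lambda}}$ and $\mathcal{O}_{G,\Lambda}$ are isomorphic C*-algebras. -/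

import Mathlib

open scoped ENNReal

universe u v

set_option linter.unusedSectionVars false

noncomputable section

/-! ## Universal C*-algebras given by generators and relations -/

/-- A system of relations on families `(f i)` of elements of unital C*-algebras, indexed by the set
`ι` of generators, together with the (necessary) requirement that the relations bound the norm of
each generator uniformly over all C*-algebras. -/
structure CStarRelations (ι : Type u) where
  holds : ∀ (B : Type u) [CStarAlgebra B], (ι → B) → Prop
  bounded : ∀ i, ∃ C : ℝ, ∀ (B : Type u) [CStarAlgebra B] (f : ι → B), holds B f → ‖f i‖ ≤ C

namespace CStarRelations

variable {ι : Type u} (R : CStarRelations ι)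

/-- The value of a noncommutative `*`-polynomial in the generators at the family `f`. -/
def eval {B : Type v} [CStarAlgebra B] (f : ι → B) : FreeAlgebra ℂ (ι ⊕ ι) →ₐ[ℂ] B :=
  FreeAlgebra.lift ℂ (Sum.elim f fun i => star (f i))

/-- A family satisfying the relations in a nonzero unital C*-algebra. -/
structure Model where
  carrier : Type u
  [alg : CStarAlgebra carrier]
  [nontriv : Nontrivial carrier]
  gen : ι → carrier
  rel : R.holds carrier gen

attribute [instance] Model.alg Model.nontriv

variable {R} in
/-- The seminorm on `*`-polynomials which is defined by a model. -/
def Model.seminorm (M : R.Model) (w : FreeAlgebra ℂ (ι ⊕ ι)) : ℝ := ‖eval M.gen w‖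

/-- The set of all seminorms on the free `*`-algebra that come from models. -/
def Seminorms : Type u :=
  {N : FreeAlgebra ℂ (ι ⊕ ι) → ℝ // ∃ M : R.Model, M.seminorm = N}

/-- A model for each seminorm. (It is enough to take one model per seminorm.) -/
def model (N : R.Seminorms) : R.Model := N.2.choose

lemma model_seminorm (N : R.Seminorms) : (R.model N).seminorm = N.1 := N.2.choose_spec

/-- The `ℓ^∞`-product of the chosen models. -/
abbrev Ambient : Type u := lp (fun N : R.Seminorms => (R.model N).carrier) ∞

instance : CStarAlgebra R.Ambient where

/-- The family of generators in the product of the models. -/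
def ambientGen (i : ι) : R.Ambient :=
  ⟨fun N => (R.model N).gen i, memℓp_infty (by
    obtain ⟨C, hC⟩ := R.bounded i
    exact ⟨C, by rintro _ ⟨N, rfl⟩; exact hC _ _ (R.model N).rel⟩)⟩

/-- The unital C*-algebra generated by the generators in the product of the models. -/
def ambientSub : StarSubalgebra ℂ R.Ambient :=
  (StarAlgebra.adjoin ℂ (Set.range R.ambientGen)).topologicalClosure

instance : IsClosed (R.ambientSub : Set R.Ambient) :=
  StarSubalgebra.isClosed_topologicalClosure _

/-- The universal unital C*-algebra generated by a family `gen` subject to the relations: if a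
family `f` in a unital C*-algebra `B` satisfies the relations, there is exactly one unital
`*`-homomorphism to `B` which takes `gen i` to `f i`, see `existsUnique_lift`. -/
def Universal : Type u := R.ambientSub

instance : CStarAlgebra R.Universal :=
  inferInstanceAs (CStarAlgebra R.ambientSub)

/-- The universal family. -/
def gen (i : ι) : R.Universal :=
  ⟨R.ambientGen i, StarSubalgebra.le_topologicalClosure _ (StarAlgebra.subset_adjoin ℂ _ ⟨i, rfl⟩)⟩


lemma mem_adjoin_range {B : Type v} [CStarAlgebra B] (f : ι → B) (x : B)
    (hx : x ∈ StarAlgebra.adjoin ℂ (Set.range f)) : ∃ w, eval f w = x := by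
  have h : x ∈ (eval f).range := by
    rw [eval, ← Algebra.adjoin_range_eq_range_freeAlgebra_lift]
    have hx' : x ∈ (StarAlgebra.adjoin ℂ (Set.range f)).toSubalgebra := hx
    rw [StarAlgebra.adjoin_toSubalgebra] at hx'
    refine Algebra.adjoin_mono ?_ hx'
    rintro y (⟨i, rfl⟩ | hy)
    · exact ⟨Sum.inl i, rfl⟩
    · obtain ⟨i, hi⟩ := Set.mem_star.mp hy
      exact ⟨Sum.inr i, by simp [hi]⟩
  exact h

lemma map_eval {B : Type v} [CStarAlgebra B] {C : Type*} [CStarAlgebra C] (π : B →⋆ₐ[ℂ] C)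
    (f : ι → B) (w : FreeAlgebra ℂ (ι ⊕ ι)) : π (eval f w) = eval (fun i => π (f i)) w := by
  have : (π : B →ₐ[ℂ] C).comp (eval f) = eval fun i => π (f i) := by
    apply FreeAlgebra.hom_ext
    funext i
    rcases i with i | i <;> simp [eval, map_star]
  exact DFunLike.congr_fun this w

/-- The coordinate representations of the universal algebra. -/
def coord (N : R.Seminorms) : R.Universal →⋆ₐ[ℂ] (R.model N).carrier where
  toFun x := x.1 N
  map_one' := rfl
  map_mul' _ _ := rfl
  map_zero' := rfl
  map_add' _ _ := rfl
  commutes' _ := rfl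
  map_star' _ := rfl

@[simp] lemma coord_gen (N : R.Seminorms) (i : ι) : R.coord N (R.gen i) = (R.model N).gen i := rfl

lemma norm_coord_le (N : R.Seminorms) (x : R.Universal) : ‖R.coord N x‖ ≤ ‖x‖ :=
  lp.norm_apply_le_norm (by simp) x.1 N

variable {R} in
lemma ext_coord {x y : R.Universal} (h : ∀ N, R.coord N x = R.coord N y) : x = y :=
  Subtype.ext (lp.ext (funext h))

/-- A closed `*`-subalgebra containing the generators is everything. -/
lemma eq_top_of_closed (S : StarSubalgebra ℂ R.Universal) (hS : IsClosed (S : Set R.Universal))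
    (h : ∀ i, R.gen i ∈ S) (x : R.Universal) : x ∈ S := by
  have key : ∀ (y : R.Ambient) (hy : y ∈ StarAlgebra.adjoin ℂ (Set.range R.ambientGen)),
      (⟨y, StarSubalgebra.le_topologicalClosure _ hy⟩ : R.Universal) ∈ S := by
    intro y hy
    obtain ⟨w, hw⟩ := mem_adjoin_range R.ambientGen y hy
    have hh : eval R.gen w ∈ S := by
      have hle : (eval R.gen).range ≤ S.toSubalgebra := by
        rw [eval, ← Algebra.adjoin_range_eq_range_freeAlgebra_lift, Algebra.adjoin_le_iff]
        rintro _ ⟨i | i, rfl⟩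
        · exact h i
        · exact S.star_mem' (h i)
      exact hle ⟨w, rfl⟩
    have : eval R.gen w = (⟨y, StarSubalgebra.le_topologicalClosure _ hy⟩ : R.Universal) := by
      apply Subtype.ext
      have := map_eval (ι := ι) (R.ambientSub.subtype : R.Universal →⋆ₐ[ℂ] R.Ambient) R.gen w
      exact this.trans hw
    rwa [← this]
  have hx : (x.1 : R.Ambient) ∈ closure
      (StarAlgebra.adjoin ℂ (Set.range R.ambientGen) : Set R.Ambient) := x.2
  obtain ⟨y, hy, hlim⟩ := mem_closure_iff_seq_limit.mp hx
  refine hS.mem_of_tendsto (f := fun n => (⟨y n, StarSubalgebra.le_topologicalClosure _ (hy n)⟩ :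
    R.Universal)) (b := Filter.atTop) ?_ (Filter.Eventually.of_forall fun n => key _ (hy n))
  exact tendsto_subtype_rng.mpr hlim

lemma norm_eval_le {B : Type u} [CStarAlgebra B] (f : ι → B) (hf : R.holds B f)
    (w : FreeAlgebra ℂ (ι ⊕ ι)) : ‖eval f w‖ ≤ ‖eval R.gen w‖ := by
  rcases subsingleton_or_nontrivial B with hB | hB
  · rw [Subsingleton.elim (eval f w) 0, norm_zero]; exact norm_nonneg _
  · let M : R.Model := ⟨B, f, hf⟩
    let N : R.Seminorms := ⟨M.seminorm, M, rfl⟩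
    have h1 : ‖eval f w‖ = ‖eval (R.model N).gen w‖ :=
      (congr_fun (R.model_seminorm N) w).symm
    rw [h1, ← funext (R.coord_gen N), ← map_eval]
    exact R.norm_coord_le N _

open scoped CStarAlgebra in
/-- The universal property. -/
theorem existsUnique_lift {B : Type u} [CStarAlgebra B] (f : ι → B) (hf : R.holds B f) :
    ∃! π : R.Universal →⋆ₐ[ℂ] B, ∀ i, π (R.gen i) = f i := by
  refine existsUnique_of_exists_of_unique ?_ ?_
  · let T : StarSubalgebra ℂ (R.Universal × B) :=
      (StarAlgebra.adjoin ℂ (Set.range fun i => (R.gen i, f i))).topologicalClosure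
    have hTc : IsClosed (T : Set (R.Universal × B)) := StarSubalgebra.isClosed_topologicalClosure _
    have hT : ∀ t ∈ T, ‖t.2‖ ≤ ‖t.1‖ := by
      intro t ht
      have ht' : t ∈ closure (StarAlgebra.adjoin ℂ (Set.range fun i => (R.gen i, f i)) :
        Set (R.Universal × B)) := ht
      refine closure_minimal (t := {t : R.Universal × B | ‖t.2‖ ≤ ‖t.1‖}) ?_
        (isClosed_le (by fun_prop) (by fun_prop)) ht'
      intro s hs
      obtain ⟨w, rfl⟩ := mem_adjoin_range _ s hs
      have h1 := map_eval (StarAlgHom.fst ℂ R.Universal B) (fun i => (R.gen i, f i)) w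
      have h2 := map_eval (StarAlgHom.snd ℂ R.Universal B) (fun i => (R.gen i, f i)) w
      simp only [StarAlgHom.fst_apply, StarAlgHom.snd_apply] at h1 h2
      simp only [Set.mem_ofPred_eq, h1, h2]
      exact R.norm_eval_le f hf w
    let p : T →⋆ₐ[ℂ] R.Universal := (StarAlgHom.fst ℂ R.Universal B).comp T.subtype
    have hiso : Isometry p := by
      refine AddMonoidHomClass.isometry_of_norm p fun t => ?_
      change ‖t.1.1‖ = max ‖t.1.1‖ ‖t.1.2‖
      exact (max_eq_left (hT _ t.2)).symm
    have : CompleteSpace T := hTc.completeSpace_coe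
    have hsurj : Function.Surjective p := by
      intro x
      exact R.eq_top_of_closed p.range hiso.isClosedEmbedding.isClosed_range
        (fun i => ⟨⟨(R.gen i, f i), StarSubalgebra.le_topologicalClosure _
          (StarAlgebra.subset_adjoin ℂ _ ⟨i, rfl⟩)⟩, rfl⟩) x
    let e : T ≃⋆ₐ[ℂ] R.Universal := StarAlgEquiv.ofBijective p ⟨hiso.injective, hsurj⟩
    refine ⟨((StarAlgHom.snd ℂ R.Universal B).comp T.subtype).comp
      (e.symm : R.Universal →⋆ₐ[ℂ] T), fun i => ?_⟩
    have : e.symm (R.gen i) = ⟨(R.gen i, f i), StarSubalgebra.le_topologicalClosure _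
          (StarAlgebra.subset_adjoin ℂ _ ⟨i, rfl⟩)⟩ := by
      rw [StarAlgEquiv.symm_apply_eq]; rfl
    change (e.symm (R.gen i)).1.2 = f i
    rw [this]
  · intro π₁ π₂ h₁ h₂
    ext x
    refine R.eq_top_of_closed (StarAlgHom.equalizer π₁ π₂) ?_ (fun i => ?_) x
    · exact isClosed_eq (map_continuous π₁) (map_continuous π₂)
    · exact (h₁ i).trans (h₂ i).symm

end CStarRelations

/-! ## Right Hilbert modules, adjointable and compact operators -/

/-- `E` is a right Hilbert module over `A`. The right action is written as `MulOpposite.op a • x`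
for `x · a`; the `A`-valued inner product `ip` is linear in the second variable, conjugate-linear
in the first, satisfies `⟨x, y · a⟩ = ⟨x, y⟩ a`, `⟨x, y⟩* = ⟨y, x⟩` and `⟨x, x⟩ ≥ 0`, the norm of `E`
is `‖⟨x, x⟩‖^(1/2)`, and `E` is complete. -/
class RightHilbertModule (A : Type*) [CStarAlgebra A] (E : Type*) [NormedAddCommGroup E]
    [NormedSpace ℂ E] [Module Aᵐᵒᵖ E] where
  ip : E → E → A
  ip_add_right : ∀ x y z, ip x (y + z) = ip x y + ip x z
  ip_smul_right : ∀ (c : ℂ) x y, ip x (c • y) = c • ip x y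
  ip_op_smul_right : ∀ (a : A) x y, ip x (MulOpposite.op a • y) = ip x y * a
  star_ip : ∀ x y, star (ip x y) = ip y x
  ip_self_nonneg : ∀ x, ∃ b, ip x x = star b * b
  norm_sq : ∀ x, ‖x‖ ^ 2 = ‖ip x x‖
  complete : CompleteSpace E

namespace RightHilbertModule

variable (A : Type*) [CStarAlgebra A] {E : Type*} [NormedAddCommGroup E]
  [NormedSpace ℂ E] [Module Aᵐᵒᵖ E] [RightHilbertModule A E]

local notation "⟪" x ", " y "⟫" => RightHilbertModule.ip (A := A) x y

lemma ip_add_left (x y z : E) : ⟪x + y, z⟫ = ⟪x, z⟫ + ⟪y, z⟫ := by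
  rw [← star_ip z, ip_add_right, star_add, star_ip, star_ip]

lemma ip_smul_left (c : ℂ) (x y : E) : ⟪c • x, y⟫ = star c • ⟪x, y⟫ := by
  rw [← star_ip y, ip_smul_right, star_smul, star_ip]

lemma ip_op_smul_left (a : A) (x y : E) : ⟪MulOpposite.op a • x, y⟫ = star a * ⟪x, y⟫ := by
  rw [← star_ip y, ip_op_smul_right, star_mul, star_ip]

lemma ip_zero_right (x : E) : ⟪x, 0⟫ = 0 := by
  simpa using ip_smul_right (A := A) (0 : ℂ) x 0

lemma ip_zero_left (x : E) : ⟪0, x⟫ = 0 := by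
  rw [← star_ip, ip_zero_right, star_zero]

lemma ip_neg_right (x y : E) : ⟪x, -y⟫ = -⟪x, y⟫ := by
  simpa using ip_smul_right (A := A) (-1 : ℂ) x y

lemma ip_sub_right (x y z : E) : ⟪x, y - z⟫ = ⟪x, y⟫ - ⟪x, z⟫ := by
  rw [sub_eq_add_neg, ip_add_right, ip_neg_right, sub_eq_add_neg]

variable {A} in
lemma eq_of_ip_left {x y : E} (h : ∀ z, ⟪z, x⟫ = ⟪z, y⟫) : x = y := by
  rw [← sub_eq_zero, ← norm_eq_zero, ← sq_eq_zero_iff, norm_sq (A := A), ip_sub_right, h,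
    sub_self, norm_zero]

/-- The Cauchy–Schwarz inequality. -/
lemma norm_ip_le (x y : E) : ‖⟪x, y⟫‖ ≤ ‖x‖ * ‖y‖ := by
  let _ : PartialOrder Aᵐᵒᵖ := CStarAlgebra.spectralOrder Aᵐᵒᵖ
  have : StarOrderedRing Aᵐᵒᵖ := CStarAlgebra.spectralOrderedRing Aᵐᵒᵖ
  let _ : CStarModule Aᵐᵒᵖ E :=
    { inner := fun x y => MulOpposite.op ⟪x, y⟫
      inner_add_right := by intro x y z; rw [ip_add_right, MulOpposite.op_add]
      inner_self_nonneg := by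
        intro x
        obtain ⟨b, hb⟩ := ip_self_nonneg (A := A) x
        change 0 ≤ MulOpposite.op ⟪x, x⟫
        rw [hb, MulOpposite.op_mul, MulOpposite.op_star]
        exact mul_star_self_nonneg _
      inner_self := by
        intro x
        change MulOpposite.op ⟪x, x⟫ = 0 ↔ x = 0
        rw [MulOpposite.op_eq_zero_iff, ← norm_eq_zero, ← norm_sq, sq_eq_zero_iff, norm_eq_zero]
      inner_op_smul_right := by
        intro a x y
        change MulOpposite.op ⟪x, a • y⟫ = a * MulOpposite.op ⟪x, y⟫
        conv_lhs => rw [← MulOpposite.op_unop a, ip_op_smul_right, MulOpposite.op_mul]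
        rfl
      inner_smul_right_complex := by intro c x y; rw [ip_smul_right, MulOpposite.op_smul]
      star_inner := by intro x y; rw [← MulOpposite.op_star, star_ip]
      norm_eq_sqrt_norm_inner_self := by
        intro x
        change ‖x‖ = √‖⟪x, x⟫‖
        rw [← norm_sq, Real.sqrt_sq (norm_nonneg _)] }
  exact CStarModule.norm_inner_le (A := Aᵐᵒᵖ) E (x := x) (y := y)

variable (E)

/-- The algebra `L(E)` of adjointable operators. (An adjointable operator is automatically
`A`-linear and bounded.) -/
def adjointable : Subalgebra ℂ (Module.End ℂ E) where
  carrier := {T | ∃ T' : Module.End ℂ E, ∀ x y, ⟪T x, y⟫ = ⟪x, T' y⟫}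
  mul_mem' := by
    rintro S T ⟨S', hS⟩ ⟨T', hT⟩
    exact ⟨T' * S', fun x y => by simp [hS, hT]⟩
  add_mem' := by
    rintro S T ⟨S', hS⟩ ⟨T', hT⟩
    exact ⟨S' + T', fun x y => by simp [hS, hT, ip_add_left, ip_add_right]⟩
  algebraMap_mem' c := ⟨star c • 1, fun x y => by
    simp [Algebra.algebraMap_eq_smul_one, ip_smul_left, ip_smul_right]⟩

variable {A E}

lemma adjoint_unique {T : E → E} {S S' : Module.End ℂ E}
    (h : ∀ x y, ⟪T x, y⟫ = ⟪x, S y⟫) (h' : ∀ x y, ⟪T x, y⟫ = ⟪x, S' y⟫) : S = S' :=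
  LinearMap.ext fun y => eq_of_ip_left (A := A) fun z => by rw [← h, h']

/-- The adjoint of an adjointable operator. -/
instance : Star (adjointable A E) where
  star T := ⟨T.2.choose, T.1, fun x y => by
    rw [← star_ip, ← T.2.choose_spec, star_ip]⟩

lemma ip_apply_left (T : adjointable A E) (x y : E) : ⟪T.1 x, y⟫ = ⟪x, (star T).1 y⟫ :=
  T.2.choose_spec x y

lemma ip_apply_right (T : adjointable A E) (x y : E) : ⟪x, T.1 y⟫ = ⟪(star T).1 x, y⟫ := by
  rw [← star_ip, ip_apply_left, star_ip]

lemma star_eq_of_ip {T S : adjointable A E} (h : ∀ x y, ⟪T.1 x, y⟫ = ⟪x, S.1 y⟫) : star T = S :=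
  Subtype.ext (adjoint_unique (ip_apply_left T) h)

instance : StarRing (adjointable A E) where
  star_involutive T := star_eq_of_ip fun x y => (ip_apply_right T x y).symm
  star_mul S T := star_eq_of_ip fun x y => by
    change ⟪S.1 (T.1 x), y⟫ = ⟪x, (star T).1 ((star S).1 y)⟫
    rw [ip_apply_left, ip_apply_left]
  star_add S T := star_eq_of_ip fun x y => by
    change ⟪S.1 x + T.1 x, y⟫ = ⟪x, (star S).1 y + (star T).1 y⟫
    rw [ip_add_left, ip_add_right, ip_apply_left, ip_apply_left]

instance : StarModule ℂ (adjointable A E) where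
  star_smul c T := star_eq_of_ip fun x y => by
    change ⟪c • T.1 x, y⟫ = ⟪x, star c • (star T).1 y⟫
    rw [ip_smul_left, ip_smul_right, ip_apply_left]

/-- The rank-one operator `Θ_{x,y} : z ↦ x · ⟨y, z⟩`. -/
def theta (x y : E) : adjointable A E where
  val :=
    { toFun := fun z => MulOpposite.op ⟪y, z⟫ • x
      map_add' := fun z w => by rw [ip_add_right, MulOpposite.op_add, add_smul]
      map_smul' := fun c z => eq_of_ip_left (A := A) fun w => by
        simp only [ip_smul_right, ip_op_smul_right, RingHom.id_apply, mul_smul_comm] }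
  property := ⟨
    { toFun := fun z => MulOpposite.op ⟪x, z⟫ • y
      map_add' := fun z w => by rw [ip_add_right, MulOpposite.op_add, add_smul]
      map_smul' := fun c z => eq_of_ip_left (A := A) fun w => by
        simp only [ip_smul_right, ip_op_smul_right, RingHom.id_apply, mul_smul_comm] }, fun z w => by
      simp [ip_op_smul_left, ip_op_smul_right, star_ip]⟩

lemma theta_apply (x y z : E) : (theta x y : adjointable A E).1 z = MulOpposite.op ⟪y, z⟫ • x := rfl

lemma star_theta (x y : E) : star (theta x y : adjointable A E) = theta y x :=
  star_eq_of_ip fun z w => by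
    simp [theta_apply, ip_op_smul_left, ip_op_smul_right, star_ip]

lemma theta_mul (x y : E) (T : adjointable A E) : theta x y * T = theta x ((star T).1 y) :=
  Subtype.ext <| LinearMap.ext fun z => by
    change MulOpposite.op ⟪y, T.1 z⟫ • x = MulOpposite.op ⟪(star T).1 y, z⟫ • x
    rw [ip_apply_right]

variable (A E) in
/-- The linear span of the rank-one operators. -/
def finiteRank : Submodule ℂ (adjointable A E) :=
  Submodule.span ℂ (Set.range fun xy : E × E => theta xy.1 xy.2)

/-- The operator norm of `T` is at most `C` (for `0 ≤ C`). -/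
def NormLE (T : adjointable A E) (C : ℝ) : Prop := ∀ x, ‖T.1 x‖ ≤ C * ‖x‖

lemma NormLE.star {T : adjointable A E} {C : ℝ} (h : NormLE T C) : NormLE (star T) C := by
  intro x
  by_cases h0 : ‖(Star.star T).1 x‖ = 0
  · rw [h0]
    by_cases hx : ‖x‖ = 0
    · simp [hx]
    · have := (norm_nonneg _).trans (h x)
      exact this
  · have h0' : 0 < ‖(Star.star T).1 x‖ := lt_of_le_of_ne (norm_nonneg _) (Ne.symm h0)
    refine le_of_mul_le_mul_right ?_ h0'
    rw [← sq, norm_sq (A := A), ← ip_apply_left]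
    refine (norm_ip_le A _ _).trans ?_
    nlinarith [h ((Star.star T).1 x), norm_nonneg x]

lemma finiteRank_bounded {S : adjointable A E} (hS : S ∈ finiteRank A E) :
    ∃ C, 0 ≤ C ∧ NormLE S C := by
  induction hS using Submodule.span_induction with
  | mem _ h =>
    obtain ⟨⟨x, y⟩, rfl⟩ := h
    refine ⟨‖x‖ * ‖y‖, by positivity, fun z => ?_⟩
    refine le_of_sq_le_sq ?_ (by positivity)
    rw [theta_apply, norm_sq (A := A), ip_op_smul_left, ip_op_smul_right]
    have h1 := norm_ip_le A y z
    have h2 := norm_sq (A := A) x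
    calc _ ≤ ‖star ⟪y, z⟫‖ * (‖⟪x, x⟫‖ * ‖⟪y, z⟫‖) :=
          (norm_mul_le _ _).trans (by gcongr; exact norm_mul_le _ _)
      _ ≤ (‖y‖ * ‖z‖) * (‖x‖ ^ 2 * (‖y‖ * ‖z‖)) := by rw [norm_star, h2]; gcongr
      _ = _ := by ring
  | zero => exact ⟨0, le_rfl, fun z => by simp⟩
  | add S T _ _ hS hT =>
    obtain ⟨C, hC, hS⟩ := hS
    obtain ⟨C', hC', hT⟩ := hT
    refine ⟨C + C', by positivity, fun z => ?_⟩
    change ‖S.1 z + T.1 z‖ ≤ _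
    rw [add_mul]
    exact (norm_add_le _ _).trans (add_le_add (hS z) (hT z))
  | smul c S _ hS =>
    obtain ⟨C, hC, hS⟩ := hS
    refine ⟨‖c‖ * C, by positivity, fun z => ?_⟩
    change ‖c • S.1 z‖ ≤ _
    rw [norm_smul, mul_assoc]
    gcongr
    exact hS z

lemma finiteRank_mul {S : adjointable A E} (hS : S ∈ finiteRank A E) (T : adjointable A E) :
    S * T ∈ finiteRank A E := by
  induction hS using Submodule.span_induction with
  | mem _ h =>
    obtain ⟨⟨x, y⟩, rfl⟩ := h
    rw [theta_mul]
    exact Submodule.subset_span ⟨(x, _), rfl⟩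
  | zero => rw [zero_mul]; exact zero_mem _
  | add S S' _ _ hS hS' => rw [add_mul]; exact add_mem hS hS'
  | smul c S _ hS => rw [smul_mul_assoc]; exact Submodule.smul_mem _ _ hS

lemma finiteRank_star {S : adjointable A E} (hS : S ∈ finiteRank A E) :
    star S ∈ finiteRank A E := by
  induction hS using Submodule.span_induction with
  | mem _ h =>
    obtain ⟨⟨x, y⟩, rfl⟩ := h
    rw [star_theta]
    exact Submodule.subset_span ⟨(y, x), rfl⟩
  | zero => rw [star_zero]; exact zero_mem _
  | add S S' _ _ hS hS' => rw [star_add]; exact add_mem hS hS'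
  | smul c S _ hS => rw [star_smul]; exact Submodule.smul_mem _ _ hS

variable (A E) in
/-- The C*-algebra `K(E)` of (generalized) compact operators: the closure, in the operator norm,
of the span of the rank-one operators. -/
def compacts : NonUnitalStarSubalgebra ℂ (adjointable A E) where
  carrier := {T | ∀ ε > 0, ∃ S ∈ finiteRank A E, NormLE (T - S) ε}
  zero_mem' ε hε := ⟨0, zero_mem _, fun x => by
    rw [sub_zero]; simpa using by positivity⟩
  add_mem' := by
    intro T T' hT hT' ε hε
    obtain ⟨S, hS, h⟩ := hT (ε / 2) (by positivity)
    obtain ⟨S', hS', h'⟩ := hT' (ε / 2) (by positivity)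
    refine ⟨S + S', add_mem hS hS', fun x => ?_⟩
    have : (T + T' - (S + S')).1 x = (T - S).1 x + (T' - S').1 x := by
      rw [add_sub_add_comm]; rfl
    rw [this]
    refine (norm_add_le _ _).trans ((add_le_add (h x) (h' x)).trans (le_of_eq (by ring)))
  smul_mem' := by
    intro c T hT ε hε
    obtain ⟨S, hS, h⟩ := hT (ε / (‖c‖ + 1)) (by positivity)
    refine ⟨c • S, Submodule.smul_mem _ _ hS, fun x => ?_⟩
    rw [← smul_sub]
    change ‖c • (T - S).1 x‖ ≤ _
    rw [norm_smul]
    calc _ ≤ (‖c‖ + 1) * (ε / (‖c‖ + 1) * ‖x‖) := by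
          gcongr
          · exact le_add_of_nonneg_right zero_le_one
          · exact h x
      _ = _ := by field_simp
  mul_mem' := by
    intro T T' hT hT' ε hε
    obtain ⟨S', hS', h'⟩ := hT' 1 one_pos
    obtain ⟨C, hC, hC'⟩ := finiteRank_bounded hS'
    obtain ⟨S, hS, h⟩ := hT (ε / (C + 1)) (by positivity)
    refine ⟨S * T', finiteRank_mul hS T', fun x => ?_⟩
    rw [← sub_mul]
    change ‖(T - S).1 (T'.1 x)‖ ≤ _
    have hT'x : ‖T'.1 x‖ ≤ (C + 1) * ‖x‖ := by
      have : T'.1 x = (T' - S').1 x + S'.1 x := by simp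
      rw [this]
      refine (norm_add_le _ _).trans ((add_le_add (h' x) (hC' x)).trans (le_of_eq (by ring)))
    calc _ ≤ ε / (C + 1) * ‖T'.1 x‖ := h _
      _ ≤ ε / (C + 1) * ((C + 1) * ‖x‖) := by gcongr
      _ = _ := by field_simp
  star_mem' := by
    intro T hT ε hε
    obtain ⟨S, hS, h⟩ := hT ε hε
    refine ⟨star S, finiteRank_star hS, ?_⟩
    have hsub : star T - star S = star (T - S) := (star_sub T S).symm
    rw [hsub]
    exact h.star

lemma finiteRank_le_compacts {S : adjointable A E} (hS : S ∈ finiteRank A E) :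
    S ∈ compacts A E := fun ε hε => ⟨S, hS, fun x => by simpa using by positivity⟩

lemma theta_mem_compacts (x y : E) : (theta x y : adjointable A E) ∈ compacts A E :=
  finiteRank_le_compacts (Submodule.subset_span ⟨(x, y), rfl⟩)

/-- `Θ_{x,y}` as an element of `K(E)`. -/
def rankOne (x y : E) : compacts A E := ⟨theta x y, theta_mem_compacts x y⟩

end RightHilbertModule

/-! ## Product systems -/

open RightHilbertModule

/-- A product system over the commutative monoid `P` with coefficients in the (unital) C*-algebra
`A`. The fibres `X_p` are essential C*-correspondences over `A` (right Hilbert modules with a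
`*`-homomorphism `leftAct p : A → L(X_p)`) on which `A` acts by compact operators. The fibre `X_0` is
identified with `A`, as a Hilbert module, by means of `unit`; the multiplication
`X_p × X_q → X_{p+q}` is associative and `X_0 = A` multiplies by the left and the right action.
The fields `ip_mul` and `mul_total` say that `x ⊗ y ↦ xy` is an isomorphism of
`X_p ⊗_A X_q` onto `X_{p+q}`: the inner product on the left of `ip_mul` is that of `x ⊗ y` and
`x' ⊗ y'` in `X_p ⊗_A X_q`, so that the map is isometric, and its range is dense by `mul_total`.
To avoid transports, the multiplication takes values in `X_r` for any `r` with a proof of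
`p + q = r`. -/
structure ProductSystem (P : Type) [AddCommMonoid P] (A : Type u) [CStarAlgebra A] where
  fiber : P → Type u
  [normedGroup : ∀ p, NormedAddCommGroup (fiber p)]
  [normedSpace : ∀ p, NormedSpace ℂ (fiber p)]
  [rightModule : ∀ p, Module Aᵐᵒᵖ (fiber p)]
  [hilbert : ∀ p, RightHilbertModule A (fiber p)]
  leftAct : ∀ p, A →⋆ₙₐ[ℂ] adjointable A (fiber p)
  leftAct_compact : ∀ p a, leftAct p a ∈ compacts A (fiber p)
  essential : ∀ p (x : fiber p),
    x ∈ closure (Submodule.span ℂ {y | ∃ a z, y = (leftAct p a).1 z} : Set (fiber p))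
  unit : A ≃ₗ[ℂ] fiber 0
  ip_unit : ∀ a b, ip (A := A) (unit a) (unit b) = star a * b
  mul : ∀ {p q r}, p + q = r → fiber p →ₗ[ℂ] fiber q →ₗ[ℂ] fiber r
  unit_mul : ∀ {p} (a : A) (x : fiber p), mul (zero_add p) (unit a) x = (leftAct p a).1 x
  mul_unit : ∀ {p} (x : fiber p) (a : A), mul (add_zero p) x (unit a) = MulOpposite.op a • x
  mul_assoc : ∀ {p q r pq qr pqr} (h₁ : p + q = pq) (h₂ : pq + r = pqr) (h₃ : q + r = qr)
    (h₄ : p + qr = pqr) (x : fiber p) (y : fiber q) (z : fiber r),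
    mul h₂ (mul h₁ x y) z = mul h₄ x (mul h₃ y z)
  ip_mul : ∀ {p q r} (h : p + q = r) (x x' : fiber p) (y y' : fiber q),
    ip (A := A) (mul h x y) (mul h x' y') = ip (A := A) y ((leftAct q (ip x x')).1 y')
  mul_total : ∀ {p q r} (h : p + q = r) (z : fiber r),
    z ∈ closure (Submodule.span ℂ {w | ∃ x y, w = mul h x y} : Set (fiber r))

namespace ProductSystem

attribute [instance] normedGroup normedSpace rightModule hilbert

variable {P : Type} [AddCommMonoid P] {A : Type u} [CStarAlgebra A] (X : ProductSystem P A)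

/-- A representation `ψ` of the product system `X` in the C*-algebra `B`: linear maps `ψ_p` on `X_p`
such that `ψ_0` is a `*`-homomorphism of `A = X_0` (called `coeff`), `ψ_p(a · x) = ψ_0(a) ψ_p(x)`,
`ψ_p(x)* ψ_p(y) = ψ_0(⟨x, y⟩)` and `ψ_p(x) ψ_q(y) = ψ_{p+q}(x y)`. -/
structure Representation (B : Type*) [NonUnitalCStarAlgebra B] where
  toMap : ∀ p, X.fiber p →ₗ[ℂ] B
  coeff : A →⋆ₙₐ[ℂ] B
  coeff_apply : ∀ a, coeff a = toMap 0 (X.unit a)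
  map_leftAct : ∀ p a (x : X.fiber p), toMap p ((X.leftAct p a).1 x) = coeff a * toMap p x
  star_mul_map : ∀ p (x y : X.fiber p), star (toMap p x) * toMap p y = coeff (ip x y)
  map_mul : ∀ {p q r} (h : p + q = r) (x : X.fiber p) (y : X.fiber q),
    toMap r (X.mul h x y) = toMap p x * toMap q y

variable {X}

/-- `Ψ` is the homomorphism `ψ_p^{(1)} : K(X_p) → B`, which is determined by
`ψ_p^{(1)}(Θ_{x,y}) = ψ_p(x) ψ_p(y)*`. (Such a `Ψ` is unique, since `*`-homomorphisms of C*-algebras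
are continuous.) -/
def Representation.IsCompactExtension {B : Type*} [NonUnitalCStarAlgebra B]
    (ψ : X.Representation B) (p : P) (Ψ : compacts A (X.fiber p) →⋆ₙₐ[ℂ] B) : Prop :=
  ∀ x y, Ψ (rankOne x y) = ψ.toMap p x * star (ψ.toMap p y)

/-- Cuntz–Pimsner covariance: `ψ_0(a) = ψ_p^{(1)}(φ_p(a))` for all `p` and `a`, where `φ_p` is the
left action of `A` on `X_p`. -/
def Representation.CPCovariant {B : Type*} [NonUnitalCStarAlgebra B]
    (ψ : X.Representation B) : Prop :=
  ∀ p, ∃ Ψ : compacts A (X.fiber p) →⋆ₙₐ[ℂ] B, ψ.IsCompactExtension p Ψ ∧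
    ∀ a, ψ.coeff a = Ψ ⟨X.leftAct p a, X.leftAct_compact p a⟩

lemma Representation.norm_toMap_le {B : Type*} [NonUnitalCStarAlgebra B]
    (ψ : X.Representation B) (p : P) (x : X.fiber p) : ‖ψ.toMap p x‖ ≤ ‖x‖ := by
  have h : ‖ψ.toMap p x‖ ^ 2 ≤ ‖x‖ ^ 2 := by
    rw [sq, ← CStarRing.norm_star_mul_self, ψ.star_mul_map, norm_sq (A := A)]
    exact NonUnitalStarAlgHom.norm_apply_le _ _
  exact le_of_sq_le_sq h (norm_nonneg _)

variable (X)

/-- The relations between the elements `j(x)`, `x ∈ X_p`, of a C*-algebra which say that `j` is a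
Cuntz–Pimsner covariant representation of the product system. -/
def cpRelations : CStarRelations (Σ p, X.fiber p) where
  holds B _ f := ∃ ψ : X.Representation B, ψ.CPCovariant ∧ ∀ p x, f ⟨p, x⟩ = ψ.toMap p x
  bounded := by
    rintro ⟨p, x⟩
    refine ⟨‖x‖, ?_⟩
    rintro B _ f ⟨ψ, -, hf⟩
    rw [hf]
    exact ψ.norm_toMap_le p x

/-- The Cuntz–Pimsner algebra of `X` is the C*-algebra generated by a universal Cuntz–Pimsner
covariant representation. It is not required to contain the unit of the ambient universal unital
algebra: representations need not be unital. (As every C*-algebra embeds in a unital one, it does not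
matter that the universal property of the ambient algebra is about unital C*-algebras.) -/
def cuntzPimsnerAlgebra : NonUnitalStarSubalgebra ℂ X.cpRelations.Universal :=
  (NonUnitalStarAlgebra.adjoin ℂ (Set.range X.cpRelations.gen)).topologicalClosure

/-- The Cuntz–Pimsner algebra of `X`, as a type. -/
abbrev CuntzPimsnerAlgebra : Type u := X.cuntzPimsnerAlgebra

end ProductSystem

/-! ## Crossed products -/

section CrossedProduct

variable {D G : Type u} [CStarAlgebra D] [Group G] (α : G →* (D ≃⋆ₐ[ℂ] D))

lemma norm_unitary_le {B : Type*} [CStarAlgebra B] (U : unitary B) : ‖(U : B)‖ ≤ 1 := by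
  rcases subsingleton_or_nontrivial B with h | h
  · rw [Subsingleton.elim (U : B) 0, norm_zero]; exact zero_le_one
  · exact (CStarRing.norm_coe_unitary U).le

/-- The relations for a covariant representation `(π, U)` of the C*-dynamical system `(D, G, α)` with
unital `D` and discrete `G`: `π` is a unital `*`-homomorphism, `U` is a unitary representation, and
`U_g π(d) U_g* = π(α_g(d))`. -/
def crossedRelations : CStarRelations (D ⊕ G) where
  holds B _ f := ∃ (π : D →⋆ₐ[ℂ] B) (U : G →* unitary B),
    (∀ d, f (Sum.inl d) = π d) ∧ (∀ g, f (Sum.inr g) = U g) ∧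
    ∀ g d, (U g : B) * π d * star (U g : B) = π (α g d)
  bounded := by
    rintro (d | g)
    · refine ⟨‖d‖, ?_⟩
      rintro B _ f ⟨π, U, h1, h2, h3⟩
      rw [h1]
      exact NonUnitalStarAlgHom.norm_apply_le π d
    · refine ⟨1, ?_⟩
      rintro B _ f ⟨π, U, h1, h2, h3⟩
      rw [h2]
      exact norm_unitary_le _

/-- The full crossed product of a unital C*-algebra `D` by an action `α` of a discrete group `G`,
as the universal C*-algebra for covariant representations. -/
abbrev CrossedProduct : Type u := (crossedRelations α).Universal

namespace CrossedProduct

/-- The canonical homomorphism of `D` to `D ⋊ G`. -/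
def incl : D →⋆ₐ[ℂ] CrossedProduct α where
  toFun d := (crossedRelations α).gen (Sum.inl d)
  map_one' := CStarRelations.ext_coord fun N => by
    obtain ⟨π, U, h1, h2, h3⟩ := ((crossedRelations α).model N).rel
    simp [h1]
  map_mul' a b := CStarRelations.ext_coord fun N => by
    obtain ⟨π, U, h1, h2, h3⟩ := ((crossedRelations α).model N).rel
    simp [h1]
  map_zero' := CStarRelations.ext_coord fun N => by
    obtain ⟨π, U, h1, h2, h3⟩ := ((crossedRelations α).model N).rel
    simp [h1]
  map_add' a b := CStarRelations.ext_coord fun N => by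
    obtain ⟨π, U, h1, h2, h3⟩ := ((crossedRelations α).model N).rel
    simp [h1]
  commutes' c := CStarRelations.ext_coord fun N => by
    obtain ⟨π, U, h1, h2, h3⟩ := ((crossedRelations α).model N).rel
    rw [CStarRelations.coord_gen, h1, AlgHomClass.commutes, AlgHomClass.commutes]
  map_star' a := CStarRelations.ext_coord fun N => by
    obtain ⟨π, U, h1, h2, h3⟩ := ((crossedRelations α).model N).rel
    simp [h1, map_star]

/-- The canonical unitary representation of `G` in `D ⋊ G`. -/
def unit : G →* unitary (CrossedProduct α) where
  toFun g := ⟨(crossedRelations α).gen (Sum.inr g), by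
    rw [Unitary.mem_iff]
    constructor <;>
    · refine CStarRelations.ext_coord fun N => ?_
      obtain ⟨π, U, h1, h2, h3⟩ := ((crossedRelations α).model N).rel
      simp [h2, map_star]⟩
  map_one' := Subtype.ext <| CStarRelations.ext_coord fun N => by
    obtain ⟨π, U, h1, h2, h3⟩ := ((crossedRelations α).model N).rel
    simp [h2]
  map_mul' a b := Subtype.ext <| CStarRelations.ext_coord fun N => by
    obtain ⟨π, U, h1, h2, h3⟩ := ((crossedRelations α).model N).rel
    simp [h2]

lemma covariance (g : G) (d : D) :
    (unit α g : CrossedProduct α) * incl α d = incl α (α g d) * unit α g := by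
  refine CStarRelations.ext_coord fun N => ?_
  obtain ⟨π, U, h1, h2, h3⟩ := ((crossedRelations α).model N).rel
  simp [unit, incl, h1, h2, ← h3, mul_assoc]

/-- A closed subspace that contains all products `d g` is everything. -/
lemma induction_on {p : CrossedProduct α → Prop} (hc : IsClosed {a | p a}) (h0 : p 0)
    (hadd : ∀ a b, p a → p b → p (a + b))
    (h : ∀ d g, p (incl α d * unit α g)) (a : CrossedProduct α) : p a := by
  have hsm : ∀ (c : ℂ) d g, p (c • (incl α d * unit α g)) := fun c d g => by
    rw [← smul_mul_assoc, ← map_smul]; exact h _ _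
  let W : Submodule ℂ (CrossedProduct α) :=
    Submodule.span ℂ (Set.range fun dg : D × G => incl α dg.1 * (unit α dg.2 : CrossedProduct α))
  have hW : ∀ w ∈ W, p w := by
    intro w hw
    obtain ⟨t, f, ht, rfl⟩ := Submodule.mem_span_set'.mp hw
    refine Finset.sum_induction _ p hadd h0 fun i _ => ?_
    obtain ⟨⟨d, g⟩, hdg⟩ := (ht i).2
    rw [← hdg]
    exact hsm _ _ _
  have hmul : ∀ x ∈ W, ∀ y ∈ W, x * y ∈ W := by
    intro x hx y hy
    induction hx, hy using Submodule.span_induction₂ with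
    | mem_mem x y hx hy =>
      obtain ⟨⟨d, g⟩, rfl⟩ := hx
      obtain ⟨⟨d', g'⟩, rfl⟩ := hy
      refine Submodule.subset_span ⟨(d * α g d', g * g'), ?_⟩
      simp only [map_mul, Submonoid.coe_mul]
      rw [mul_assoc, ← mul_assoc (incl α (α g d')), ← covariance]
      simp only [mul_assoc]
    | zero_left y hy => rw [zero_mul]; exact zero_mem _
    | zero_right x hx => rw [mul_zero]; exact zero_mem _
    | add_left x y z _ _ _ h1 h2 => rw [add_mul]; exact add_mem h1 h2
    | add_right x y z _ _ _ h1 h2 => rw [mul_add]; exact add_mem h1 h2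
    | smul_left r x y _ _ h => rw [smul_mul_assoc]; exact Submodule.smul_mem _ _ h
    | smul_right r x y _ _ h => rw [mul_smul_comm]; exact Submodule.smul_mem _ _ h
  have hone : (1 : CrossedProduct α) ∈ W := Submodule.subset_span ⟨(1, 1), by simp⟩
  have hstar : ∀ x ∈ W, star x ∈ W := by
    intro x hx
    induction hx using Submodule.span_induction with
    | mem x hx =>
      obtain ⟨⟨d, g⟩, rfl⟩ := hx
      refine Submodule.subset_span ⟨(α g⁻¹ (star d), g⁻¹), ?_⟩
      simp only []
      rw [← covariance, star_mul, ← map_star, map_inv, ← Unitary.star_eq_inv, Unitary.coe_star]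
    | zero => rw [star_zero]; exact zero_mem _
    | add x y _ _ h1 h2 => rw [star_add]; exact add_mem h1 h2
    | smul c x _ h => rw [star_smul]; exact Submodule.smul_mem _ _ h
  let S : StarSubalgebra ℂ (CrossedProduct α) :=
    { W with
      mul_mem' := fun {x y} hx hy => hmul x hx y hy
      algebraMap_mem' := fun c => by
        rw [Algebra.algebraMap_eq_smul_one]; exact W.smul_mem _ hone
      star_mem' := fun {x} hx => hstar x hx }
  have hS := (crossedRelations α).eq_top_of_closed S.topologicalClosure
    (StarSubalgebra.isClosed_topologicalClosure _) (by
      rintro (d | g)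
      · exact StarSubalgebra.le_topologicalClosure S (Submodule.subset_span ⟨(d, 1), by
          simp [incl]⟩)
      · exact StarSubalgebra.le_topologicalClosure S (Submodule.subset_span ⟨(1, g), by
          simp [unit]⟩)) a
  exact closure_minimal (fun w hw => hW w hw) hc hS

end CrossedProduct

end CrossedProduct

/-! ## Higher-rank graphs and self-similar actions -/

/-- A higher-rank graph over the monoid `P` of degrees (a `k`-graph, for `P = ℕ^k`), as a small
category given by its set `Λ` of morphisms: every object is identified with its identity morphism, so
that the source and the range of a morphism are morphisms. The composite `comp μ ν` is written `μν`
and is defined when `s(μ) = r(ν)`. The degree is a functor to `P` with the unique factorization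
property. -/
class HigherRankGraph (P : outParam Type) [AddCommMonoid P] (Λ : Type u) where
  deg : Λ → P
  src : Λ → Λ
  rng : Λ → Λ
  comp : ∀ μ ν : Λ, src μ = rng ν → Λ
  src_src : ∀ μ, src (src μ) = src μ
  rng_src : ∀ μ, rng (src μ) = src μ
  src_rng : ∀ μ, src (rng μ) = rng μ
  rng_rng : ∀ μ, rng (rng μ) = rng μ
  src_comp : ∀ μ ν (h : src μ = rng ν), src (comp μ ν h) = src ν
  rng_comp : ∀ μ ν (h : src μ = rng ν), rng (comp μ ν h) = rng μ
  id_comp : ∀ μ, comp (rng μ) μ (src_rng μ) = μ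
  comp_id : ∀ μ, comp μ (src μ) (rng_src μ).symm = μ
  comp_assoc : ∀ lam μ ν (h : src lam = rng μ) (h' : src μ = rng ν),
    comp (comp lam μ h) ν ((src_comp lam μ h).trans h') =
      comp lam (comp μ ν h') (h.trans (rng_comp μ ν h').symm)
  deg_src : ∀ μ, deg (src μ) = 0
  deg_rng : ∀ μ, deg (rng μ) = 0
  deg_comp : ∀ μ ν (h : src μ = rng ν), deg (comp μ ν h) = deg μ + deg ν
  factorization : ∀ (lam : Λ) (m n : P), deg lam = m + n →
    ∃! μν : Λ × Λ, deg μν.1 = m ∧ deg μν.2 = n ∧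
      ∃ h : src μν.1 = rng μν.2, comp μν.1 μν.2 h = lam

namespace HigherRankGraph

variable {P : Type} [AddCommMonoid P] (Λ : Type u) [HigherRankGraph P Λ]

/-- The set `Λ^n` of paths of degree `n`. -/
abbrev Path (n : P) : Type u := {μ : Λ // deg μ = n}

/-- The set `Λ^0` of vertices, that is, of paths of degree `0`. These are the identity morphisms,
see `deg_src`, `deg_rng`, `src_vertex` and `rng_vertex`. -/
abbrev Vertex : Type u := Path Λ (0 : P)

/-- For all vertices `v` and all degrees `n`, the set `vΛ^n` is finite. -/
class RowFinite : Prop where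
  finite_paths : ∀ (v : Vertex Λ) (n : P), {μ : Λ | rng μ = v.1 ∧ deg μ = n}.Finite

/-- For all vertices `v` and all degrees `n`, the set `vΛ^n` is nonempty. -/
class NoSources : Prop where
  exists_path : ∀ (v : Vertex Λ) (n : P), {μ : Λ | rng μ = v.1 ∧ deg μ = n}.Nonempty

variable {Λ}

/-- The source of a path, as a vertex. -/
def srcV (μ : Λ) : Vertex Λ := ⟨src μ, deg_src μ⟩

/-- The range of a path, as a vertex. -/
def rngV (μ : Λ) : Vertex Λ := ⟨rng μ, deg_rng μ⟩

/-- Paths of degree zero are identity morphisms. -/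
lemma src_vertex (v : Vertex Λ) : src v.1 = v.1 := by
  have h := factorization v.1 (0 : P) 0 (by rw [v.2, add_zero])
  have := h.unique (y₁ := (rng v.1, v.1)) (y₂ := (v.1, src v.1))
    ⟨deg_rng _, v.2, src_rng _, id_comp _⟩ ⟨v.2, deg_src _, (rng_src _).symm, comp_id _⟩
  exact (congrArg Prod.snd this).symm

lemma rng_vertex (v : Vertex Λ) : rng v.1 = v.1 := by
  rw [← src_vertex v, rng_src]

variable (Λ) in
instance [Finite (Vertex Λ)] [RowFinite Λ] (n : P) : Finite (Path Λ n) := by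
  have : ({μ : Λ | deg μ = n}).Finite := by
    have h : {μ : Λ | deg μ = n} ⊆ ⋃ v : Vertex Λ, {μ : Λ | rng μ = v.1 ∧ deg μ = n} :=
      fun μ hμ => Set.mem_iUnion.mpr ⟨rngV μ, rfl, hμ⟩
    exact (Set.finite_iUnion fun v => RowFinite.finite_paths v n).subset h
  exact this.to_subtype

end HigherRankGraph

open HigherRankGraph

/-- A self-similar action of `G` on the higher-rank graph `Λ`: an action by bijections that preserve
degree, source and range, with a restriction map `(g, μ) ↦ res g μ = g|_μ` such that, whenever
`s(μ) = r(ν)`, `g · (μν) = (g · μ)(g|_μ · ν)` and `g|_{μν} = (g|_μ)|_ν`, and moreover `g|_v = g` for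
vertices, `1|_μ = 1` and `(gh)|_μ = g|_{h · μ} h|_μ`. The field `src_smul_eq_rng` says that the
composite `(g · μ)(g|_μ · ν)` is defined. -/
class SelfSimilarAction {P : outParam Type} [AddCommMonoid P] (G Λ : Type u) [Group G]
    [HigherRankGraph P Λ] extends MulAction G Λ where
  deg_smul : ∀ (g : G) (μ : Λ), deg (g • μ) = deg μ
  src_smul : ∀ (g : G) (μ : Λ), src (g • μ) = g • src μ
  rng_smul : ∀ (g : G) (μ : Λ), rng (g • μ) = g • rng μ
  res : G → Λ → G
  src_smul_eq_rng : ∀ (g : G) (μ ν : Λ), src μ = rng ν → src (g • μ) = rng (res g μ • ν)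
  smul_comp : ∀ (g : G) (μ ν : Λ) (h : src μ = rng ν),
    g • comp μ ν h = comp (g • μ) (res g μ • ν) (src_smul_eq_rng g μ ν h)
  res_vertex : ∀ (g : G) (v : Vertex Λ), res g v.1 = g
  res_comp : ∀ (g : G) (μ ν : Λ) (h : src μ = rng ν), res g (comp μ ν h) = res (res g μ) ν
  res_one : ∀ μ : Λ, res 1 μ = 1
  res_mul : ∀ (g h : G) (μ : Λ), res (g * h) μ = res g (h • μ) * res h μ

/-! ## The self-similar algebra -/

/-- A Cuntz–Krieger `Λ`-family of partial isometries in the C*-algebra `B`. -/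
structure IsCuntzKriegerFamily {P : Type} [AddCommMonoid P] {Λ : Type u} [HigherRankGraph P Λ]
    {B : Type*} [NonUnitalCStarAlgebra B] (S : Λ → B) : Prop where
  partialIsometry : ∀ μ, S μ * star (S μ) * S μ = S μ
  projection : ∀ v : Vertex Λ, IsStarProjection (S v.1)
  orthogonal : ∀ v w : Vertex Λ, v ≠ w → S v.1 * S w.1 = 0
  mul : ∀ μ ν (h : src μ = rng ν), S (comp μ ν h) = S μ * S ν
  star_mul : ∀ μ, star (S μ) * S μ = S (src μ)
  sum : ∀ (v : Vertex Λ) (n : P), S v.1 = ∑ᶠ μ ∈ {μ : Λ | rng μ = v.1 ∧ deg μ = n}, S μ * star (S μ)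

section SelfSimilar

variable {P : Type} [AddCommMonoid P] (G Λ : Type u) [Group G] [HigherRankGraph P Λ]
  [SelfSimilarAction G Λ]

/-- The relations that define the C*-algebra of a self-similar action: `U` is a unitary
representation of `G`, `S` is a Cuntz–Krieger `Λ`-family, `∑_v S_v = 1` (for finite `Λ^0`), and
`U_g S_μ = S_{g · μ} U_{g|_μ}`. -/
def selfSimilarRelations : CStarRelations (G ⊕ Λ) where
  holds B _ f := ∃ (U : G →* unitary B) (S : Λ → B),
    (∀ g, f (Sum.inl g) = U g) ∧ (∀ μ, f (Sum.inr μ) = S μ) ∧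
    IsCuntzKriegerFamily S ∧ (∑ᶠ v : Vertex Λ, S v.1 = 1) ∧
    ∀ g μ, (U g : B) * S μ = S (g • μ) * U (SelfSimilarAction.res g μ)
  bounded := by
    rintro (g | μ)
    · refine ⟨1, ?_⟩
      rintro B _ f ⟨U, S, h1, -⟩
      rw [h1]
      exact norm_unitary_le _
    · refine ⟨1, ?_⟩
      rintro B _ f ⟨U, S, -, h2, h3, -⟩
      rw [h2]
      have hp := h3.projection (srcV μ)
      have h4 : ‖S μ‖ * ‖S μ‖ = ‖S (src μ)‖ := by
        rw [← CStarRing.norm_star_mul_self, h3.star_mul]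
      have h5 : ‖S (src μ)‖ ≤ 1 := hp.norm_le
      nlinarith [norm_nonneg (S μ)]

/-- The universal unital C*-algebra `O_{G,Λ}` of a self-similar action. -/
abbrev SelfSimilarAlgebra : Type u := (selfSimilarRelations G Λ).Universal

end SelfSimilar

/-! ## The product system -/

namespace SelfSimilar

section

variable {P : Type} [AddCommMonoid P] (G Λ : Type u) [Group G] [HigherRankGraph P Λ]
  [SelfSimilarAction G Λ]

variable {G Λ} in
instance (n : P) : MulAction G (Path Λ n) where
  smul g μ := ⟨g • μ.1, (SelfSimilarAction.deg_smul g μ.1).trans μ.2⟩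
  one_smul μ := Subtype.ext (one_smul G μ.1)
  mul_smul g h μ := Subtype.ext (mul_smul g h μ.1)

lemma coe_smul (n : P) (g : G) (μ : Path Λ n) : (g • μ).1 = g • μ.1 := rfl

variable [Finite (Vertex Λ)] [RowFinite Λ]

instance (n : P) : Fintype (Path Λ n) := Fintype.ofFinite _

open scoped Classical in
instance (n : P) : DecidableEq (Path Λ n) := inferInstance

/-- The action of `G` on `C(Λ^0)`, which takes `δ_v` to `δ_{g · v}`. -/
def vertexAction : G →* ((Vertex Λ → ℂ) ≃⋆ₐ[ℂ] (Vertex Λ → ℂ)) where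
  toFun g :=
    { toFun := fun f v => f (g⁻¹ • v)
      invFun := fun f v => f (g • v)
      left_inv := fun f => by funext v; simp
      right_inv := fun f => by funext v; simp
      map_mul' := fun _ _ => rfl
      map_add' := fun _ _ => rfl
      map_smul' := fun _ _ => rfl
      map_star' := fun _ => rfl }
  map_one' := by ext f v; change f ((1 : G)⁻¹ • v) = f v; simp
  map_mul' g h := by
    ext f v
    change f ((g * h)⁻¹ • v) = f (h⁻¹ • (g⁻¹ • v))
    rw [mul_inv_rev, mul_smul]

/-- The coefficient algebra `A_{G,Λ} = C(Λ^0) ⋊ G`. -/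
abbrev CoeffAlgebra : Type u := CrossedProduct (vertexAction G Λ)

variable {Λ}

/-- The projection `j(δ_v)` in `A_{G,Λ}`. -/
def q (v : Vertex Λ) : CoeffAlgebra G Λ := CrossedProduct.incl (vertexAction G Λ) (Pi.single v 1)

variable {G} (Λ) in
/-- The unitary `j(g)` in `A_{G,Λ}`. -/
def u (g : G) : CoeffAlgebra G Λ := (CrossedProduct.unit (vertexAction G Λ) g).1

lemma star_q (v : Vertex Λ) : star (q G v) = q G v := by
  rw [q, ← map_star]
  congr 1
  funext w
  by_cases h : w = v
  · subst h; simp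
  · simp [h]

lemma q_mul_q_self (v : Vertex Λ) : q G v * q G v = q G v := by
  rw [q, ← map_mul, ← Pi.single_mul, one_mul]

lemma q_mul_q_of_ne {v w : Vertex Λ} (h : v ≠ w) : q G v * q G w = 0 := by
  rw [q, q, ← map_mul]
  have : (Pi.single v 1 : Vertex Λ → ℂ) * Pi.single w 1 = 0 := by
    funext x
    by_cases hv : x = v
    · subst hv; simp [h]
    · simp [hv]
  rw [this, map_zero]

variable (Λ) in
lemma sum_q : ∑ v : Vertex Λ, q G v = 1 := by
  simp only [q]
  rw [← map_sum, Finset.univ_sum_single (fun _ : Vertex Λ => (1 : ℂ))]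
  exact map_one _

lemma incl_eq_sum (d : Vertex Λ → ℂ) :
    CrossedProduct.incl (vertexAction G Λ) d = ∑ v, d v • q G v := by
  simp only [q, ← map_smul, ← map_sum]
  congr 1
  conv_lhs => rw [← Finset.univ_sum_single d]
  refine Finset.sum_congr rfl fun v _ => ?_
  rw [← Pi.single_smul, smul_eq_mul, mul_one]

variable {G}

lemma u_mul_q (g : G) (v : Vertex Λ) : u Λ g * q G v = q G (g • v) * u Λ g := by
  rw [q, u, CrossedProduct.covariance]
  congr 2
  funext w
  change (Pi.single v 1 : Vertex Λ → ℂ) (g⁻¹ • w) = _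
  by_cases h : w = g • v
  · subst h; simp
  · have : g⁻¹ • w ≠ v := fun h' => h (by rw [← h', smul_inv_smul])
    simp [h, this]

lemma u_mul (g h : G) : u Λ (g * h) = u Λ g * u Λ h := by simp [u]

lemma u_one : u Λ (1 : G) = 1 := by simp [u]

lemma star_u (g : G) : star (u Λ g) = u Λ g⁻¹ := by
  simp [u, ← Unitary.star_eq_inv]

variable (G Λ)

/-- The direct sum over `μ ∈ Λ^n` of the closed right ideals `j(δ_{s(μ)}) A_{G,Λ}`. (The ideal
`j(δ_{s(μ)}) A_{G,Λ}` is the set of all `a` with `j(δ_{s(μ)}) a = a`.) -/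
def fiberSub (n : P) : Submodule ℂ (Path Λ n → CoeffAlgebra G Λ) where
  carrier := {x | ∀ μ, q G (srcV μ.1) * x μ = x μ}
  zero_mem' μ := mul_zero _
  add_mem' hx hy μ := by rw [Pi.add_apply, mul_add, hx, hy]
  smul_mem' c x hx μ := by rw [Pi.smul_apply, mul_smul_comm, hx]

/-- The Hilbert module `X_{G,Λ,n}` over `A_{G,Λ}`, with `⟨x, y⟩ = ∑_μ x(μ)* y(μ)` and with the right
multiplication in each coordinate. -/
def Fiber (n : P) : Type u := fiberSub G Λ n

variable {G Λ} {n : P}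

instance : CoeFun (Fiber G Λ n) fun _ => Path Λ n → CoeffAlgebra G Λ := ⟨fun x => x.1⟩

@[ext] lemma Fiber.ext {x y : Fiber G Λ n} (h : ∀ μ, x μ = y μ) : x = y := Subtype.ext (funext h)

lemma Fiber.q_mul (x : Fiber G Λ n) (μ : Path Λ n) : q G (srcV μ.1) * x μ = x μ := x.2 μ

instance : AddCommGroup (Fiber G Λ n) := inferInstanceAs (AddCommGroup (fiberSub G Λ n))

instance : Module ℂ (Fiber G Λ n) := inferInstanceAs (Module ℂ (fiberSub G Λ n))

@[simp] lemma Fiber.add_apply (x y : Fiber G Λ n) (μ : Path Λ n) : (x + y) μ = x μ + y μ := rfl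
@[simp] lemma Fiber.smul_apply (c : ℂ) (x : Fiber G Λ n) (μ : Path Λ n) : (c • x) μ = c • x μ := rfl
@[simp] lemma Fiber.zero_apply (μ : Path Λ n) : (0 : Fiber G Λ n) μ = 0 := rfl

instance : Module (CoeffAlgebra G Λ)ᵐᵒᵖ (Fiber G Λ n) where
  smul a x := ⟨fun μ => x μ * a.unop, fun μ => by rw [← mul_assoc, x.q_mul]⟩
  one_smul x := Fiber.ext fun μ => mul_one _
  mul_smul a b x := Fiber.ext fun μ => (mul_assoc (x μ) b.unop a.unop).symm
  smul_zero a := Fiber.ext fun μ => zero_mul _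
  smul_add a x y := Fiber.ext fun μ => add_mul _ _ _
  add_smul a b x := Fiber.ext fun μ => mul_add _ _ _
  zero_smul x := Fiber.ext fun μ => mul_zero _

@[simp] lemma Fiber.op_smul_apply (a : CoeffAlgebra G Λ) (x : Fiber G Λ n) (μ : Path Λ n) :
    (MulOpposite.op a • x) μ = x μ * a := rfl

section Norm

local instance : PartialOrder (CoeffAlgebra G Λ)ᵐᵒᵖ := CStarAlgebra.spectralOrder _
local instance : StarOrderedRing (CoeffAlgebra G Λ)ᵐᵒᵖ := CStarAlgebra.spectralOrderedRing _

variable (G Λ n) in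
/-- The embedding in the standard Hilbert module, which serves to define the norm. -/
def column : Fiber G Λ n →ₗ[ℂ]
    WithCStarModule (CoeffAlgebra G Λ)ᵐᵒᵖ (Path Λ n → (CoeffAlgebra G Λ)ᵐᵒᵖ) where
  toFun x := (WithCStarModule.equiv _ _).symm fun μ => MulOpposite.op (x μ)
  map_add' _ _ := rfl
  map_smul' _ _ := rfl

lemma column_apply (x : Fiber G Λ n) (μ : Path Λ n) : column G Λ n x μ = MulOpposite.op (x μ) := rfl

lemma column_injective : Function.Injective (column G Λ n) := fun x y h => Fiber.ext fun μ => by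
  have := congrArg (fun z => z μ) h
  simpa [column_apply] using this

instance : NormedAddCommGroup (Fiber G Λ n) :=
  NormedAddCommGroup.induced _ _ (column G Λ n) column_injective

instance : NormedSpace ℂ (Fiber G Λ n) := NormedSpace.induced ℂ _ _ (column G Λ n)

lemma Fiber.norm_sq (x : Fiber G Λ n) : ‖x‖ ^ 2 = ‖∑ μ, star (x μ) * x μ‖ := by
  change ‖column G Λ n x‖ ^ 2 = _
  rw [WithCStarModule.pi_norm_sq, ← MulOpposite.norm_op (∑ μ, star (x μ) * x μ),
    Finset.op_sum]
  rfl

instance : CompleteSpace (Fiber G Λ n) := by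
  have hind : IsUniformInducing (column G Λ n) :=
    (AddMonoidHomClass.isometry_of_norm (column G Λ n) fun _ => rfl).isUniformInducing
  rw [completeSpace_iff_isComplete_range hind]
  apply IsClosed.isComplete
  have : Set.range (column G Λ n) =
      ⋂ μ : Path Λ n, {y | MulOpposite.op (q G (srcV μ.1) * (y μ).unop) = y μ} := by
    ext y
    simp only [Set.mem_range, Set.mem_iInter, Set.mem_ofPred_eq]
    constructor
    · rintro ⟨x, rfl⟩ μ
      rw [column_apply, MulOpposite.unop_op, x.q_mul]
    · intro h
      exact ⟨⟨fun μ => (y μ).unop, fun μ => MulOpposite.op_injective (h μ)⟩, rfl⟩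
  rw [this]
  refine isClosed_iInter fun μ => isClosed_eq ?_ ?_
  · have : Continuous fun y : WithCStarModule (CoeffAlgebra G Λ)ᵐᵒᵖ
        (Path Λ n → (CoeffAlgebra G Λ)ᵐᵒᵖ) => y μ :=
      (continuous_apply μ).comp WithCStarModule.uniformEquiv.continuous
    exact MulOpposite.continuous_op.comp
      (continuous_const.mul (MulOpposite.continuous_unop.comp this))
  · exact (continuous_apply μ).comp WithCStarModule.uniformEquiv.continuous

lemma exists_sum_star_mul_self (x : Fiber G Λ n) :
    ∃ b, ∑ μ, star (x μ) * x μ = star b * b := by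
  let _ : PartialOrder (CoeffAlgebra G Λ) := CStarAlgebra.spectralOrder _
  have : StarOrderedRing (CoeffAlgebra G Λ) := CStarAlgebra.spectralOrderedRing _
  exact CStarAlgebra.nonneg_iff_eq_star_mul_self.mp
    (Finset.sum_nonneg fun μ _ => star_mul_self_nonneg (x μ))

end Norm

instance : RightHilbertModule (CoeffAlgebra G Λ) (Fiber G Λ n) where
  ip x y := ∑ μ, star (x μ) * y μ
  ip_add_right x y z := by simp [mul_add, Finset.sum_add_distrib]
  ip_smul_right c x y := by simp [Finset.smul_sum]
  ip_op_smul_right a x y := by simp [Finset.sum_mul, mul_assoc]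
  star_ip x y := by simp [star_sum]
  ip_self_nonneg := exists_sum_star_mul_self
  norm_sq := Fiber.norm_sq
  complete := inferInstance

end

end SelfSimilar

namespace SelfSimilar

section

variable {P : Type} [AddCommMonoid P] {G Λ : Type u} [Group G] [HigherRankGraph P Λ]
  [SelfSimilarAction G Λ] [Finite (Vertex Λ)] [RowFinite Λ] {n : P}

lemma srcV_smul (g : G) (μ : Path Λ n) : srcV (g • μ).1 = g • srcV μ.1 :=
  Subtype.ext (SelfSimilarAction.src_smul g μ.1)

lemma rngV_smul (g : G) (μ : Path Λ n) : rngV (g • μ).1 = g • rngV μ.1 :=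
  Subtype.ext (SelfSimilarAction.rng_smul g μ.1)

lemma res_smul_srcV (g : G) (μ : Λ) : SelfSimilarAction.res g μ • srcV μ = g • srcV μ := by
  apply Subtype.ext
  have h := SelfSimilarAction.src_smul_eq_rng g μ (src μ) (rng_src μ).symm
  rw [SelfSimilarAction.src_smul, SelfSimilarAction.rng_smul, rng_src] at h
  exact h.symm

lemma res_inv_smul (g : G) (μ : Λ) :
    SelfSimilarAction.res g⁻¹ (g • μ) = (SelfSimilarAction.res g μ)⁻¹ := by
  rw [eq_inv_iff_mul_eq_one, ← SelfSimilarAction.res_mul, inv_mul_cancel,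
    SelfSimilarAction.res_one]

section Matrix

local instance : PartialOrder (CoeffAlgebra G Λ) := CStarAlgebra.spectralOrder _
local instance : StarOrderedRing (CoeffAlgebra G Λ) := CStarAlgebra.spectralOrderedRing _

variable (G Λ n) in
/-- Matrices over `A_{G,Λ}` with rows and columns indexed by `Λ^n`. -/
abbrev Mat : Type u := CStarMatrix (Path Λ n) (Path Λ n) (CoeffAlgebra G Λ)

variable (Λ n) in
/-- The matrix of `U(g) : χ_ν a ↦ χ_{g · ν} j(g|_ν) a`. -/
def groupMatrix (g : G) : Mat G Λ n :=
  CStarMatrix.ofMatrix fun μ ν => if μ = g • ν then u Λ (SelfSimilarAction.res g ν.1) else 0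

lemma groupMatrix_apply (g : G) (μ ν : Path Λ n) :
    groupMatrix Λ n g μ ν = if μ = g • ν then u Λ (SelfSimilarAction.res g ν.1) else 0 := rfl

variable (G n) in
/-- The matrix of the operator `x ↦ (d(r(μ)) x(μ))_μ` for a function `d` on `Λ^0`. -/
def vertexMatrix (d : Vertex Λ → ℂ) : Mat G Λ n :=
  CStarMatrix.ofMatrix fun μ ν => if μ = ν then algebraMap ℂ _ (d (rngV μ.1)) else 0

lemma vertexMatrix_apply (d : Vertex Λ → ℂ) (μ ν : Path Λ n) :
    vertexMatrix G n d μ ν = if μ = ν then algebraMap ℂ _ (d (rngV μ.1)) else 0 := rfl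

lemma groupMatrix_mul (g h : G) :
    groupMatrix Λ n (g * h) = groupMatrix Λ n g * groupMatrix Λ n h := by
  ext μ ν
  rw [CStarMatrix.mul_apply, Finset.sum_eq_single (h • ν)]
  · simp only [groupMatrix_apply, mul_smul, if_true, ite_mul, zero_mul]
    rw [SelfSimilarAction.res_mul, u_mul]
    rfl
  · intro κ _ hκ
    simp [groupMatrix_apply, hκ]
  · simp

lemma groupMatrix_one : groupMatrix Λ n (1 : G) = 1 := by
  ext μ ν
  rw [groupMatrix_apply, CStarMatrix.one_apply, one_smul, SelfSimilarAction.res_one, u_one]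

lemma star_groupMatrix (g : G) : star (groupMatrix Λ n g) = groupMatrix Λ n g⁻¹ := by
  ext μ ν
  rw [CStarMatrix.star_apply, groupMatrix_apply, groupMatrix_apply]
  by_cases h : ν = g • μ
  · subst h
    rw [if_pos rfl, if_pos (inv_smul_smul g μ).symm, star_u, coe_smul, res_inv_smul]
  · rw [if_neg h, if_neg (fun h' => h (by rw [h', smul_inv_smul])), star_zero]

variable (G Λ n) in
/-- The homomorphism `d ↦ vertexMatrix d`. -/
def vertexMatrixHom : (Vertex Λ → ℂ) →⋆ₐ[ℂ] Mat G Λ n where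
  toFun := vertexMatrix G n
  map_one' := by ext μ ν; simp [vertexMatrix_apply, CStarMatrix.one_apply]
  map_mul' d e := by
    ext μ ν
    rw [CStarMatrix.mul_apply, Finset.sum_eq_single μ]
    · by_cases h : μ = ν <;> simp [vertexMatrix_apply, h]
    · intro κ _ hκ
      simp [vertexMatrix_apply, hκ.symm]
    · simp
  map_zero' := by ext μ ν; simp [vertexMatrix_apply, CStarMatrix.zero_apply]
  map_add' d e := by ext μ ν; by_cases h : μ = ν <;> simp [vertexMatrix_apply, h]
  commutes' c := by
    ext μ ν
    rw [CStarMatrix.algebraMap_apply]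
    rfl
  map_star' d := by
    ext μ ν
    rw [CStarMatrix.star_apply]
    by_cases h : μ = ν
    · subst h
      simp [vertexMatrix_apply, ← algebraMap_star_comm]
    · simp [vertexMatrix_apply, h, Ne.symm h]

variable (Λ n) in
/-- The unitary representation `g ↦ groupMatrix g`. -/
def groupMatrixHom : G →* unitary (Mat G Λ n) where
  toFun g := ⟨groupMatrix Λ n g, by
    rw [Unitary.mem_iff, star_groupMatrix, ← groupMatrix_mul, ← groupMatrix_mul,
      inv_mul_cancel, mul_inv_cancel, groupMatrix_one]
    exact ⟨rfl, rfl⟩⟩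
  map_one' := Subtype.ext groupMatrix_one
  map_mul' g h := Subtype.ext (groupMatrix_mul g h)

lemma covariant_matrix (g : G) (d : Vertex Λ → ℂ) :
    groupMatrix Λ n g * vertexMatrix G n d =
      vertexMatrix G n (vertexAction G Λ g d) * groupMatrix Λ n g := by
  ext μ ν
  rw [CStarMatrix.mul_apply, CStarMatrix.mul_apply, Finset.sum_eq_single ν,
    Finset.sum_eq_single μ]
  · rw [vertexMatrix_apply, vertexMatrix_apply, if_pos rfl, if_pos rfl, groupMatrix_apply]
    by_cases h : μ = g • ν
    · subst h
      rw [if_pos rfl, rngV_smul]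
      change _ = algebraMap ℂ _ (d (g⁻¹ • g • rngV ν.1)) * _
      rw [inv_smul_smul]
      exact (Algebra.commutes _ _).symm
    · rw [if_neg h, zero_mul, mul_zero]
  · intro κ _ hκ
    rw [vertexMatrix_apply, if_neg hκ.symm, zero_mul]
  · simp
  · intro κ _ hκ
    rw [vertexMatrix_apply, if_neg hκ, mul_zero]
  · simp

variable (G Λ n) in
lemma matrix_holds : (crossedRelations (vertexAction G Λ)).holds (Mat G Λ n)
    (Sum.elim (vertexMatrixHom G Λ n) fun g => (groupMatrixHom Λ n g).1) :=
  ⟨vertexMatrixHom G Λ n, groupMatrixHom Λ n, fun _ => rfl, fun _ => rfl, fun g d => by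
    have h := covariant_matrix (n := n) g d
    change groupMatrix Λ n g * vertexMatrix G n d * star (groupMatrix Λ n g) =
      vertexMatrix G n (vertexAction G Λ g d)
    rw [h, mul_assoc, star_groupMatrix, ← groupMatrix_mul, mul_inv_cancel, groupMatrix_one,
      mul_one]⟩

variable (G Λ n) in
/-- The integrated form of the covariant pair (`vertexMatrixHom`, `groupMatrixHom`): the left action
of `A_{G,Λ}` in terms of matrices. -/
def leftMatrix : CoeffAlgebra G Λ →⋆ₐ[ℂ] Mat G Λ n :=
  ((crossedRelations (vertexAction G Λ)).existsUnique_lift _ (matrix_holds G Λ n)).choose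

lemma leftMatrix_incl (d : Vertex Λ → ℂ) :
    leftMatrix G Λ n (CrossedProduct.incl _ d) = vertexMatrix G n d :=
  ((crossedRelations (vertexAction G Λ)).existsUnique_lift _
    (matrix_holds G Λ n)).choose_spec.1 (Sum.inl d)

lemma leftMatrix_u (g : G) : leftMatrix G Λ n (u Λ g) = groupMatrix Λ n g :=
  ((crossedRelations (vertexAction G Λ)).existsUnique_lift _
    (matrix_holds G Λ n)).choose_spec.1 (Sum.inr g)

/-- The matrix coefficients of the left action. -/
def coef (a : CoeffAlgebra G Λ) (μ ν : Path Λ n) : CoeffAlgebra G Λ := leftMatrix G Λ n a μ ν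

lemma coef_add (a b : CoeffAlgebra G Λ) (μ ν : Path Λ n) :
    coef (a + b) μ ν = coef a μ ν + coef b μ ν := by simp [coef]

lemma coef_smul (c : ℂ) (b : CoeffAlgebra G Λ) (μ ν : Path Λ n) :
    coef (c • b) μ ν = c • coef b μ ν := by simp [coef]

lemma coef_zero (μ ν : Path Λ n) : coef (0 : CoeffAlgebra G Λ) μ ν = 0 := by
  simp [coef, CStarMatrix.zero_apply]

lemma coef_one (μ ν : Path Λ n) :
    coef (1 : CoeffAlgebra G Λ) μ ν = if μ = ν then 1 else 0 := by
  simp [coef, CStarMatrix.one_apply]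

lemma coef_mul (a b : CoeffAlgebra G Λ) (μ ν : Path Λ n) :
    coef (a * b) μ ν = ∑ κ, coef a μ κ * coef b κ ν := by
  simp only [coef, map_mul, CStarMatrix.mul_apply]

lemma star_coef (a : CoeffAlgebra G Λ) (μ ν : Path Λ n) :
    star (coef a μ ν) = coef (star a) ν μ := by
  simp only [coef, map_star, CStarMatrix.star_apply]

lemma coef_incl_mul_u (d : Vertex Λ → ℂ) (g : G) (μ ν : Path Λ n) :
    coef (CrossedProduct.incl (vertexAction G Λ) d * (CrossedProduct.unit (vertexAction G Λ) g).1)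
      μ ν = if μ = g • ν then d (rngV μ.1) • u Λ (SelfSimilarAction.res g ν.1) else 0 := by
  change (leftMatrix G Λ n (CrossedProduct.incl (vertexAction G Λ) d * u Λ g)) μ ν = _
  rw [map_mul, leftMatrix_incl, leftMatrix_u, CStarMatrix.mul_apply, Finset.sum_eq_single μ]
  · rw [vertexMatrix_apply, groupMatrix_apply, if_pos rfl, mul_ite, mul_zero, Algebra.smul_def]
  · intro κ _ hκ
    rw [vertexMatrix_apply, if_neg hκ.symm, zero_mul]
  · simp

open scoped CStarAlgebra in
lemma continuous_coef (μ ν : Path Λ n) :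
    Continuous fun a : CoeffAlgebra G Λ => coef a μ ν := by
  have h1 : Continuous (leftMatrix G Λ n) := map_continuous _
  have h2 : Continuous fun M : Mat G Λ n => M μ ν :=
    (continuous_apply ν).comp (continuous_apply μ)
  exact h2.comp h1

end Matrix

lemma q_mul_coef (a : CoeffAlgebra G Λ) (μ ν : Path Λ n) :
    q G (srcV μ.1) * coef a μ ν = coef a μ ν * q G (srcV ν.1) := by
  refine CrossedProduct.induction_on (vertexAction G Λ)
    (p := fun a => q G (srcV μ.1) * coef a μ ν = coef a μ ν * q G (srcV ν.1)) ?_ ?_ ?_ ?_ a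
  · exact isClosed_eq (continuous_const.mul (continuous_coef μ ν))
      ((continuous_coef μ ν).mul continuous_const)
  · rw [coef_zero, mul_zero, zero_mul]
  · intro a b ha hb
    rw [coef_add, mul_add, add_mul, ha, hb]
  · intro d g
    rw [coef_incl_mul_u]
    by_cases h : μ = g • ν
    · subst h
      rw [if_pos rfl, mul_smul_comm, smul_mul_assoc, u_mul_q, res_smul_srcV, srcV_smul]
    · rw [if_neg h, mul_zero, zero_mul]

/-- The left action of `A_{G,Λ}` on `X_{G,Λ,n}`. It is determined by its values on the generators:
`act_q` says that `j(δ_v)` acts as the projection onto the summands with `μ ∈ vΛ^n`, and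
`leftAct_u_chi` says that `j(g) · (χ_μ a) = χ_{g · μ} j(g|_μ) a`. -/
def act (a : CoeffAlgebra G Λ) (x : Fiber G Λ n) : Fiber G Λ n :=
  ⟨fun μ => ∑ ν, coef a μ ν * x ν, fun μ => by
    rw [Finset.mul_sum]
    refine Finset.sum_congr rfl fun ν _ => ?_
    rw [← mul_assoc, q_mul_coef, mul_assoc, x.q_mul]⟩

lemma act_apply (a : CoeffAlgebra G Λ) (x : Fiber G Λ n) (μ : Path Λ n) :
    act a x μ = ∑ ν, coef a μ ν * x ν := rfl

lemma ip_def (x y : Fiber G Λ n) :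
    ip (A := CoeffAlgebra G Λ) x y = ∑ μ, star (x μ) * y μ := rfl

lemma act_add_left (a b : CoeffAlgebra G Λ) (x : Fiber G Λ n) :
    act (a + b) x = act a x + act b x := Fiber.ext fun μ => by
  simp [act_apply, coef_add, add_mul, Finset.sum_add_distrib]

lemma act_zero_left (x : Fiber G Λ n) : act 0 x = 0 := Fiber.ext fun μ => by
  simp [act_apply, coef_zero]

lemma act_smul_left (c : ℂ) (a : CoeffAlgebra G Λ) (x : Fiber G Λ n) :
    act (c • a) x = c • act a x := Fiber.ext fun μ => by
  simp [act_apply, coef_smul, Finset.smul_sum]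

lemma act_add (a : CoeffAlgebra G Λ) (x y : Fiber G Λ n) :
    act a (x + y) = act a x + act a y := Fiber.ext fun μ => by
  simp [act_apply, mul_add, Finset.sum_add_distrib]

lemma act_smul (a : CoeffAlgebra G Λ) (c : ℂ) (x : Fiber G Λ n) :
    act a (c • x) = c • act a x := Fiber.ext fun μ => by
  simp [act_apply, Finset.smul_sum]

lemma act_one (x : Fiber G Λ n) : act 1 x = x := Fiber.ext fun μ => by
  simp [act_apply, coef_one]

lemma act_mul (a b : CoeffAlgebra G Λ) (x : Fiber G Λ n) : act (a * b) x = act a (act b x) :=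
  Fiber.ext fun μ => by
    simp only [act_apply, coef_mul, Finset.mul_sum, Finset.sum_mul]
    rw [Finset.sum_comm]
    simp only [mul_assoc]

lemma ip_act (a : CoeffAlgebra G Λ) (x y : Fiber G Λ n) :
    ip (A := CoeffAlgebra G Λ) (act a x) y = ip x (act (star a) y) := by
  simp only [ip_def, act_apply, star_sum, star_mul, Finset.sum_mul, Finset.mul_sum, star_coef]
  rw [Finset.sum_comm]
  simp only [mul_assoc]

lemma continuous_act (x : Fiber G Λ n) (μ : Path Λ n) :
    Continuous fun a : CoeffAlgebra G Λ => act a x μ := by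
  simp only [act_apply]
  exact continuous_finsetSum _ fun ν _ => (continuous_coef μ ν).mul continuous_const

lemma act_incl_mul_u (d : Vertex Λ → ℂ) (g : G) (x : Fiber G Λ n) (μ : Path Λ n) :
    act (CrossedProduct.incl (vertexAction G Λ) d * (CrossedProduct.unit (vertexAction G Λ) g).1)
      x (g • μ) = d (rngV (g • μ).1) • (u Λ (SelfSimilarAction.res g μ.1) * x μ) := by
  rw [act_apply, Finset.sum_eq_single μ]
  · rw [coef_incl_mul_u, if_pos rfl, smul_mul_assoc]
  · intro κ _ hκ
    rw [coef_incl_mul_u, if_neg fun h => hκ (smul_left_cancel g h).symm, zero_mul]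
  · simp

lemma act_u (g : G) (x : Fiber G Λ n) (μ : Path Λ n) :
    act (u Λ g) x (g • μ) = u Λ (SelfSimilarAction.res g μ.1) * x μ := by
  have := act_incl_mul_u (G := G) 1 g x μ
  rw [map_one, one_mul, Pi.one_apply, one_smul] at this
  exact this

lemma act_q (v : Vertex Λ) (x : Fiber G Λ n) (μ : Path Λ n) :
    act (q G v) x μ = if rngV μ.1 = v then x μ else 0 := by
  have := act_incl_mul_u (G := G) (Pi.single v 1) 1 x μ
  rw [map_one, OneMemClass.coe_one, mul_one, one_smul, SelfSimilarAction.res_one, u_one,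
    one_mul] at this
  rw [q, this, Pi.single_apply, ite_smul, one_smul, zero_smul]

variable (G Λ n) in
/-- The left action, as a homomorphism to the adjointable operators. -/
def leftAct : CoeffAlgebra G Λ →⋆ₙₐ[ℂ] adjointable (CoeffAlgebra G Λ) (Fiber G Λ n) where
  toFun a :=
    { val :=
        { toFun := act a
          map_add' := act_add a
          map_smul' := act_smul a }
      property := ⟨
        { toFun := act (star a)
          map_add' := act_add _
          map_smul' := act_smul _ }, ip_act a⟩ }
  map_smul' c a := Subtype.ext <| LinearMap.ext fun x => act_smul_left c a x
  map_zero' := Subtype.ext <| LinearMap.ext fun x => act_zero_left x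
  map_add' a b := Subtype.ext <| LinearMap.ext fun x => act_add_left a b x
  map_mul' a b := Subtype.ext <| LinearMap.ext fun x => act_mul a b x
  map_star' a := (star_eq_of_ip (ip_act a)).symm

lemma leftAct_apply (a : CoeffAlgebra G Λ) (x : Fiber G Λ n) :
    (leftAct G Λ n a).1 x = act a x := rfl

/-- The element `χ_μ` of `X_{G,Λ,n}`. -/
def chi (μ : Path Λ n) : Fiber G Λ n :=
  ⟨Pi.single μ (q G (srcV μ.1)), fun ν => by
    by_cases h : ν = μ
    · subst h; simp [q_mul_q_self]
    · simp [h]⟩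

lemma chi_apply_self (μ : Path Λ n) : (chi μ : Fiber G Λ n) μ = q G (srcV μ.1) :=
  Pi.single_eq_same _ _

lemma chi_apply_of_ne {μ ν : Path Λ n} (h : ν ≠ μ) : (chi μ : Fiber G Λ n) ν = 0 :=
  Pi.single_eq_of_ne h _

lemma ip_chi (μ : Path Λ n) (x : Fiber G Λ n) :
    ip (A := CoeffAlgebra G Λ) (chi μ) x = x μ := by
  rw [ip_def, Finset.sum_eq_single μ]
  · rw [chi_apply_self, star_q, x.q_mul]
  · intro ν _ h
    rw [chi_apply_of_ne h, star_zero, zero_mul]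
  · simp

lemma Fiber.sum_apply {ι : Type*} (s : Finset ι) (f : ι → Fiber G Λ n) (μ : Path Λ n) :
    (∑ i ∈ s, f i) μ = ∑ i ∈ s, f i μ := by
  induction s using Finset.cons_induction with
  | empty => rfl
  | cons a s ha ih => rw [Finset.sum_cons, Finset.sum_cons, Fiber.add_apply, ih]

lemma sum_chi (x : Fiber G Λ n) :
    ∑ μ, MulOpposite.op (x μ) • (chi μ : Fiber G Λ n) = x := Fiber.ext fun μ => by
  rw [Fiber.sum_apply, Finset.sum_eq_single μ]
  · rw [Fiber.op_smul_apply, chi_apply_self, x.q_mul]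
  · intro ν _ h
    rw [Fiber.op_smul_apply, chi_apply_of_ne h.symm, zero_mul]
  · simp

lemma leftAct_compact (a : CoeffAlgebra G Λ) :
    leftAct G Λ n a ∈ compacts (CoeffAlgebra G Λ) (Fiber G Λ n) := by
  have h1 : ∑ μ : Path Λ n, (theta (chi μ) (chi μ) :
      adjointable (CoeffAlgebra G Λ) (Fiber G Λ n)) = 1 := by
    apply Subtype.ext
    ext1 x
    rw [AddSubmonoidClass.coe_finsetSum, LinearMap.sum_apply]
    simp only [theta_apply, ip_chi]
    exact sum_chi x
  have h2 : (1 : adjointable (CoeffAlgebra G Λ) (Fiber G Λ n)) ∈ finiteRank _ _ := by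
    rw [← h1]
    exact sum_mem fun μ _ => Submodule.subset_span ⟨(chi μ, chi μ), rfl⟩
  rw [← one_mul (leftAct G Λ n a)]
  exact finiteRank_le_compacts (finiteRank_mul h2 _)

end

end SelfSimilar

namespace HigherRankGraph

variable {P : Type} [AddCommMonoid P] {Λ : Type u} [HigherRankGraph P Λ] {m n r : P}

/-- The composite of two paths, with its degree. -/
def join (h : m + n = r) (μ : Path Λ m) (ν : Path Λ n) (hs : src μ.1 = rng ν.1) : Path Λ r :=
  ⟨comp μ.1 ν.1 hs, by rw [deg_comp, μ.2, ν.2, h]⟩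

lemma exists_split (h : m + n = r) (lam : Path Λ r) :
    ∃ (μ : Path Λ m) (ν : Path Λ n) (hs : src μ.1 = rng ν.1), join h μ ν hs = lam := by
  obtain ⟨⟨μ, ν⟩, ⟨hμ, hν, hs, hc⟩, -⟩ := factorization lam.1 m n (lam.2.trans h.symm)
  exact ⟨⟨μ, hμ⟩, ⟨ν, hν⟩, hs, Subtype.ext hc⟩

/-- The initial segment `μ` of degree `m` of `λ = μν`. -/
def head (h : m + n = r) (lam : Path Λ r) : Path Λ m := (exists_split h lam).choose

/-- The final segment `ν` of degree `n` of `λ = μν`. -/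
def tail (h : m + n = r) (lam : Path Λ r) : Path Λ n := (exists_split h lam).choose_spec.choose

lemma src_head (h : m + n = r) (lam : Path Λ r) : src (head h lam).1 = rng (tail h lam).1 :=
  (exists_split h lam).choose_spec.choose_spec.choose

lemma join_head_tail (h : m + n = r) (lam : Path Λ r) :
    join h (head h lam) (tail h lam) (src_head h lam) = lam :=
  (exists_split h lam).choose_spec.choose_spec.choose_spec

lemma join_inj (h : m + n = r) {μ μ' : Path Λ m} {ν ν' : Path Λ n} {hs : src μ.1 = rng ν.1}
    {hs' : src μ'.1 = rng ν'.1} (he : join h μ ν hs = join h μ' ν' hs') : μ = μ' ∧ ν = ν' := by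
  have hu := (factorization (join h μ ν hs).1 m n ((join h μ ν hs).2.trans h.symm)).unique
    (y₁ := (μ.1, ν.1)) (y₂ := (μ'.1, ν'.1)) ⟨μ.2, ν.2, hs, rfl⟩
    ⟨μ'.2, ν'.2, hs', (congrArg Subtype.val he).symm⟩
  exact ⟨Subtype.ext (congrArg Prod.fst hu), Subtype.ext (congrArg Prod.snd hu)⟩

lemma head_join (h : m + n = r) (μ : Path Λ m) (ν : Path Λ n) (hs : src μ.1 = rng ν.1) :
    head h (join h μ ν hs) = μ := (join_inj h (join_head_tail h (join h μ ν hs))).1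

lemma tail_join (h : m + n = r) (μ : Path Λ m) (ν : Path Λ n) (hs : src μ.1 = rng ν.1) :
    tail h (join h μ ν hs) = ν := (join_inj h (join_head_tail h (join h μ ν hs))).2

lemma srcV_tail (h : m + n = r) (lam : Path Λ r) : srcV (tail h lam).1 = srcV lam.1 := by
  apply Subtype.ext
  conv_rhs => rw [← join_head_tail h lam]
  exact (src_comp _ _ _).symm

lemma rngV_head (h : m + n = r) (lam : Path Λ r) : rngV (head h lam).1 = rngV lam.1 := by
  apply Subtype.ext
  conv_rhs => rw [← join_head_tail h lam]
  exact (rng_comp _ _ _).symm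

lemma rngV_tail (h : m + n = r) (lam : Path Λ r) :
    rngV (tail h lam).1 = srcV (head h lam).1 := Subtype.ext (src_head h lam).symm

end HigherRankGraph

namespace SelfSimilar

section

variable {P : Type} [AddCommMonoid P] {G Λ : Type u} [Group G] [HigherRankGraph P Λ]
  [SelfSimilarAction G Λ] [Finite (Vertex Λ)] [RowFinite Λ] {m n r : P}

/-- The multiplication `X_m × X_n → X_{m+n}`: the coordinate of `x y` at `μν` is the coordinate at `ν`
of `x(μ) · y`. On the elements `χ_μ j(g)` it is given by the formula in `mulFun_chi_chi`. -/
def mulFun (h : m + n = r) (x : Fiber G Λ m) (y : Fiber G Λ n) : Fiber G Λ r :=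
  ⟨fun lam => act (x (head h lam)) y (tail h lam), fun lam => by
    rw [← srcV_tail h lam]; exact Fiber.q_mul _ _⟩

lemma mulFun_apply (h : m + n = r) (x : Fiber G Λ m) (y : Fiber G Λ n) (lam : Path Λ r) :
    mulFun h x y lam = act (x (head h lam)) y (tail h lam) := rfl

variable (G Λ) in
/-- The multiplication as a bilinear map. -/
def mulMap (h : m + n = r) : Fiber G Λ m →ₗ[ℂ] Fiber G Λ n →ₗ[ℂ] Fiber G Λ r :=
  LinearMap.mk₂ ℂ (mulFun h)
    (fun x x' y => Fiber.ext fun lam => by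
      rw [mulFun_apply, Fiber.add_apply, act_add_left]; rfl)
    (fun c x y => Fiber.ext fun lam => by
      rw [mulFun_apply, Fiber.smul_apply, act_smul_left]; rfl)
    (fun x y y' => Fiber.ext fun lam => by
      rw [mulFun_apply, act_add]; rfl)
    (fun c x y => Fiber.ext fun lam => by
      rw [mulFun_apply, act_smul]; rfl)

lemma op_smul_chi_apply (a : CoeffAlgebra G Λ) (μ κ : Path Λ n) :
    (MulOpposite.op a • (chi μ : Fiber G Λ n)) κ =
      if κ = μ then q G (srcV μ.1) * a else 0 := by
  by_cases hκ : κ = μ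
  · rw [if_pos hκ, hκ, Fiber.op_smul_apply, chi_apply_self]
  · rw [if_neg hκ, Fiber.op_smul_apply, chi_apply_of_ne hκ, zero_mul]

/-- The formula `j(g) · (χ_μ a) = χ_{g · μ} j(g|_μ) a`. -/
lemma leftAct_u_chi (g : G) (μ : Path Λ n) (a : CoeffAlgebra G Λ) :
    act (u Λ g) (MulOpposite.op a • (chi μ : Fiber G Λ n)) =
      MulOpposite.op (u Λ (SelfSimilarAction.res g μ.1) * a) • chi (g • μ) := by
  apply Fiber.ext
  intro κ
  obtain ⟨κ, rfl⟩ := MulAction.surjective g κ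
  rw [act_u, op_smul_chi_apply, op_smul_chi_apply]
  by_cases hκ : κ = μ
  · subst hκ
    rw [if_pos rfl, if_pos rfl, ← mul_assoc, ← mul_assoc, u_mul_q, res_smul_srcV, srcV_smul]
  · rw [if_neg hκ, if_neg fun h' => hκ (smul_left_cancel g h'), mul_zero]

open scoped Classical in
/-- The formula `(χ_μ j(g)) (χ_ν j(h)) = χ_{μ (g · ν)} j(g|_ν h)` if `s(μ) = r(g · ν)`, and `0`
otherwise. -/
lemma mulFun_chi_chi (hr : m + n = r) (μ : Path Λ m) (ν : Path Λ n) (g h : G) :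
    mulFun hr (MulOpposite.op (u Λ g) • (chi μ : Fiber G Λ m))
        (MulOpposite.op (u Λ h) • (chi ν : Fiber G Λ n)) =
      if hs : src μ.1 = rng (g • ν).1 then
        MulOpposite.op (u Λ (SelfSimilarAction.res g ν.1 * h)) • chi (join hr μ (g • ν) hs)
      else 0 := by
  apply Fiber.ext
  intro lam
  rw [mulFun_apply, op_smul_chi_apply]
  by_cases h1 : head hr lam = μ
  · rw [if_pos h1, act_mul, leftAct_u_chi, act_q, op_smul_chi_apply]
    by_cases h2 : tail hr lam = g • ν
    · have hs : src μ.1 = rng (g • ν).1 := by rw [← h1, ← h2]; exact src_head hr lam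
      have h3 : lam = join hr μ (g • ν) hs := by
        rw [← join_head_tail hr lam]
        congr 1
      have h4 : rngV (tail hr lam).1 = srcV μ.1 := by rw [rngV_tail, h1]
      rw [dif_pos hs, if_pos h4, if_pos h2, op_smul_chi_apply, if_pos h3, u_mul, ← h3,
        ← srcV_tail hr lam, h2]
    · rw [if_neg h2, ite_self]
      split_ifs with hs
      · rw [op_smul_chi_apply, if_neg]
        intro h3
        exact h2 (by rw [h3, tail_join])
      · rfl
  · rw [if_neg h1, act_zero_left, Fiber.zero_apply]
    split_ifs with hs
    · rw [op_smul_chi_apply, if_neg]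
      intro h3
      exact h1 (by rw [h3, head_join])
    · rfl

/-- Components with the wrong range vanish. -/
lemma act_apply_eq_zero (x : Fiber G Λ m) (y : Fiber G Λ n) (μ : Path Λ m) (ν : Path Λ n)
    (h : rngV ν.1 ≠ srcV μ.1) : act (x μ) y ν = 0 := by
  rw [← x.q_mul μ, act_mul, act_q, if_neg h]

lemma head_smul (h : m + n = r) (g : G) (lam : Path Λ r) :
    head h (g • lam) = g • head h lam ∧
      tail h (g • lam) = SelfSimilarAction.res g (head h lam).1 • tail h lam := by
  have hs := SelfSimilarAction.src_smul_eq_rng g (head h lam).1 (tail h lam).1 (src_head h lam)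
  have he : g • lam =
      join h (g • head h lam) (SelfSimilarAction.res g (head h lam).1 • tail h lam) hs := by
    apply Subtype.ext
    conv_lhs => rw [← join_head_tail h lam]
    exact SelfSimilarAction.smul_comp g _ _ _
  rw [he, head_join, tail_join]
  exact ⟨rfl, rfl⟩

lemma res_eq (h : m + n = r) (g : G) (lam : Path Λ r) : SelfSimilarAction.res g lam.1 =
    SelfSimilarAction.res (SelfSimilarAction.res g (head h lam).1) (tail h lam).1 := by
  conv_lhs => rw [← join_head_tail h lam]
  exact SelfSimilarAction.res_comp g _ _ _

lemma act_mulFun (h : m + n = r) (a : CoeffAlgebra G Λ) (x : Fiber G Λ m) (y : Fiber G Λ n) :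
    act a (mulFun h x y) = mulFun h (act a x) y := by
  apply Fiber.ext
  intro lam
  rw [mulFun_apply]
  refine CrossedProduct.induction_on (vertexAction G Λ)
    (p := fun a => act a (mulFun h x y) lam = act (act a x (head h lam)) y (tail h lam))
    ?_ ?_ ?_ ?_ a
  · exact isClosed_eq (continuous_act _ _) ((continuous_act _ _).comp (continuous_act _ _))
  · simp only [act_zero_left, Fiber.zero_apply]
  · intro a b ha hb
    simp only [act_add_left, Fiber.add_apply, ha, hb]
  · intro d g
    obtain ⟨lam, rfl⟩ := MulAction.surjective g lam
    rw [act_incl_mul_u, (head_smul h g lam).1, (head_smul h g lam).2, act_incl_mul_u,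
      act_smul_left, act_mul, Fiber.smul_apply, act_u, mulFun_apply, ← res_eq, ← rngV_head h,
      (head_smul h g lam).1]

variable (G Λ) in
/-- The identification of `A_{G,Λ}` with `X_{G,Λ,0}`, the direct sum of the right ideals
`j(δ_v) A_{G,Λ}`, `v ∈ Λ^0`. -/
def unitEquiv : CoeffAlgebra G Λ ≃ₗ[ℂ] Fiber G Λ (0 : P) where
  toFun a := ⟨fun v => q G (srcV v.1) * a, fun v => by rw [← mul_assoc, q_mul_q_self]⟩
  invFun x := ∑ v, x v
  map_add' a b := Fiber.ext fun v => mul_add _ _ _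
  map_smul' c a := Fiber.ext fun v => mul_smul_comm _ _ _
  left_inv a := by
    change ∑ v : Vertex Λ, q G (srcV v.1) * a = a
    rw [← Finset.sum_mul]
    have : ∀ v : Vertex Λ, srcV v.1 = v := fun v => Subtype.ext (src_vertex v)
    simp only [this, sum_q, one_mul]
  right_inv x := Fiber.ext fun v => by
    change q G (srcV v.1) * ∑ w, x w = x v
    have hv : ∀ v : Vertex Λ, srcV v.1 = v := fun v => Subtype.ext (src_vertex v)
    rw [Finset.mul_sum, Finset.sum_eq_single v]
    · exact x.q_mul v
    · intro w _ hw
      rw [← x.q_mul w, ← mul_assoc, q_mul_q_of_ne, zero_mul]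
      rw [hv, hv]
      exact hw.symm
    · simp

lemma unitEquiv_apply (a : CoeffAlgebra G Λ) (v : Vertex Λ) :
    unitEquiv G Λ a v = q G v * a := by
  have : srcV v.1 = v := Subtype.ext (src_vertex v)
  conv_rhs => rw [← this]
  rfl

lemma act_unitEquiv (a b : CoeffAlgebra G Λ) :
    act a (unitEquiv G Λ b) = unitEquiv G Λ (a * b) := by
  apply Fiber.ext
  intro v
  rw [unitEquiv_apply]
  refine CrossedProduct.induction_on (vertexAction G Λ)
    (p := fun a => act a (unitEquiv G Λ b) v = q G v * (a * b)) ?_ ?_ ?_ ?_ a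
  · exact isClosed_eq (continuous_act _ _)
      (continuous_const.mul (continuous_id.mul continuous_const))
  · rw [act_zero_left, Fiber.zero_apply, zero_mul, mul_zero]
  · intro a a' ha ha'
    rw [act_add_left, Fiber.add_apply, ha, ha', add_mul, mul_add]
  · intro d g
    obtain ⟨v, rfl⟩ := MulAction.surjective g v
    rw [act_incl_mul_u, SelfSimilarAction.res_vertex, unitEquiv_apply, ← mul_assoc, u_mul_q]
    have hv : rngV (g • v).1 = g • v := Subtype.ext (rng_vertex _)
    rw [hv, incl_eq_sum, Finset.sum_mul, Finset.sum_mul, Finset.mul_sum,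
      Finset.sum_eq_single (g • v)]
    · simp only [smul_mul_assoc, mul_smul_comm, ← mul_assoc, q_mul_q_self]
      rfl
    · intro w _ hw
      simp only [smul_mul_assoc, mul_smul_comm, ← mul_assoc, q_mul_q_of_ne G hw.symm, zero_mul,
        smul_zero]
    · simp

variable (G Λ) in
/-- The product system `X_{G,Λ}` of a self-similar action on a higher-rank graph with finitely many
vertices. -/
def productSystem : ProductSystem P (CoeffAlgebra G Λ) where
  fiber := Fiber G Λ
  leftAct := leftAct G Λ
  leftAct_compact _ := leftAct_compact
  essential p x := subset_closure (Submodule.subset_span ⟨1, x, (act_one x).symm⟩)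
  unit := unitEquiv G Λ
  ip_unit a b := by
    simp only [ip_def, unitEquiv_apply, star_mul, star_q]
    simp only [mul_assoc]
    rw [← Finset.mul_sum]
    congr 1
    simp only [← mul_assoc, q_mul_q_self]
    rw [← Finset.sum_mul, sum_q, one_mul]
  mul h := mulMap G Λ h
  unit_mul {p} a x := Fiber.ext fun lam => by
    change act (unitEquiv G Λ a (head (zero_add p) lam)) x (tail (zero_add p) lam) = act a x lam
    have ht : join (zero_add p) ⟨rng lam.1, deg_rng _⟩ lam (src_rng _) = lam :=
      Subtype.ext (id_comp lam.1)
    conv_lhs => rw [← ht]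
    rw [head_join, tail_join, unitEquiv_apply, act_mul, act_q]
    exact if_pos rfl
  mul_unit {p} x a := Fiber.ext fun lam => by
    change act (x (head (add_zero p) lam)) (unitEquiv G Λ a) (tail (add_zero p) lam) = x lam * a
    have ht : join (add_zero p) lam ⟨src lam.1, deg_src _⟩ (rng_src _).symm = lam :=
      Subtype.ext (comp_id lam.1)
    conv_lhs => rw [← ht]
    rw [head_join, tail_join, act_unitEquiv, unitEquiv_apply, ← mul_assoc]
    congr 1
    exact x.q_mul lam
  mul_assoc {p q r pq qr pqr} h₁ h₂ h₃ h₄ x y z := Fiber.ext fun lam => by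
    change act (act (x (head h₁ (head h₂ lam))) y (tail h₁ (head h₂ lam))) z (tail h₂ lam) =
      act (x (head h₄ lam)) (mulFun h₃ y z) (tail h₄ lam)
    rw [act_mulFun, mulFun_apply]
    have hs : src (tail h₁ (head h₂ lam)).1 = rng (tail h₂ lam).1 := by
      rw [← src_head h₂ lam]
      exact congrArg Subtype.val (srcV_tail h₁ (head h₂ lam))
    have hj : join h₄ (head h₁ (head h₂ lam)) (join h₃ (tail h₁ (head h₂ lam)) (tail h₂ lam) hs)
        ((src_head h₁ _).trans (rng_comp _ _ hs).symm) = lam := by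
      apply Subtype.ext
      conv_rhs => rw [← join_head_tail h₂ lam]
      refine (comp_assoc _ _ _ (src_head h₁ _) hs).symm.trans ?_
      have := congrArg Subtype.val (join_head_tail h₁ (head h₂ lam))
      change comp _ _ _ = _ at this
      simp only [this]
      rfl
    have h5 : head h₄ lam = head h₁ (head h₂ lam) := by
      conv_lhs => rw [← hj]
      exact head_join _ _ _ _
    have h6 : tail h₄ lam = join h₃ (tail h₁ (head h₂ lam)) (tail h₂ lam) hs := by
      conv_lhs => rw [← hj]
      exact tail_join _ _ _ _
    rw [h5, h6, head_join, tail_join]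
  ip_mul {p q r} h x x' y y' := by
    change ip (mulFun h x y) (mulFun h x' y') = ip y (act (ip x x') y')
    have hR : ip y (act (ip (A := CoeffAlgebra G Λ) x x') y') =
        ∑ μ : Path Λ p, ∑ ν : Path Λ q,
          star (act (x μ) y ν) * act (x' μ) y' ν := by
      rw [← star_ip, ip_def x x']
      have : act (∑ μ, star (x μ) * x' μ) y' = ∑ μ, act (star (x μ) * x' μ) y' :=
        Fiber.ext fun ν => by
          rw [Fiber.sum_apply]
          simp only [act_apply]
          rw [Finset.sum_comm]
          refine Finset.sum_congr rfl fun κ _ => ?_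
          rw [← Finset.sum_mul]
          congr 1
          simp only [coef, map_sum]
          exact map_sum (⟨⟨fun M : Mat G Λ q => M ν κ, rfl⟩, fun _ _ => rfl⟩ : Mat G Λ q →+ _) _ _
      rw [star_ip, this]
      have hsum : ∀ f : Path Λ p → Fiber G Λ q, ip (A := CoeffAlgebra G Λ) y (∑ μ, f μ) =
          ∑ μ, ip y (f μ) := fun f => by
        simp only [ip_def, Fiber.sum_apply, Finset.mul_sum]
        exact Finset.sum_comm
      rw [hsum]
      refine Finset.sum_congr rfl fun μ _ => ?_
      rw [act_mul, ← ip_act, ip_def]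
    rw [hR, ip_def, ← Finset.sum_product']
    refine Finset.sum_of_injOn (fun lam => (head h lam, tail h lam)) ?_ ?_ ?_ ?_
    · intro lam _ lam' _ he
      rw [← join_head_tail h lam, ← join_head_tail h lam']
      simp only [Prod.mk.injEq] at he
      congr 1
      · exact he.1
      · exact he.2
    · intro lam _
      simp
    · rintro ⟨μ, ν⟩ _ hnot
      by_cases hs : src μ.1 = rng ν.1
      · exact absurd ⟨join h μ ν hs, by simp, by simp [head_join, tail_join]⟩ hnot
      · rw [act_apply_eq_zero x' y' μ ν, mul_zero]
        intro h'
        exact hs (congrArg Subtype.val h').symm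
    · intro lam _
      rfl
  mul_total {p q r} h z := subset_closure (by
    have hz : z = ∑ lam : Path Λ r, mulFun h (chi (head h lam))
        (MulOpposite.op (z lam) • chi (tail h lam)) := by
      apply Fiber.ext
      intro lam
      rw [Fiber.sum_apply, Finset.sum_eq_single lam]
      · rw [mulFun_apply, chi_apply_self, act_q, if_pos (rngV_tail h lam), Fiber.op_smul_apply,
          chi_apply_self, srcV_tail, z.q_mul]
      · intro lam' _ hne
        rw [mulFun_apply]
        by_cases h1 : head h lam = head h lam'
        · have h2 : tail h lam ≠ tail h lam' := fun h2 => hne (by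
            rw [← join_head_tail h lam, ← join_head_tail h lam']
            congr 1
            · exact h1.symm
            · exact h2.symm)
          rw [h1, chi_apply_self, act_q, Fiber.op_smul_apply, chi_apply_of_ne h2, zero_mul,
            ite_self]
        · rw [chi_apply_of_ne h1, act_zero_left, Fiber.zero_apply]
      · simp
    rw [hz]
    exact sum_mem fun lam _ => Submodule.subset_span ⟨_, _, rfl⟩)

end

end SelfSimilar

end

/-!
# The Cuntz–Pimsner algebra of `X_{G,Λ}` and `O_{G,Λ}`

Both algebras are universal, so it suffices to turn a representation of either kind into one of the
other kind and to check that the two resulting homomorphisms are inverse to each other on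
generators.

Let `U`, `S` be a unitary representation and a Cuntz–Krieger family with the relations of `O_{G,Λ}`.
The vertex projections and `U` are a covariant pair for the action of `G` on `C(Λ^0)`, hence define
a homomorphism `π` of `A = C(Λ^0) ⋊ G`, and `ψ_p(x) = ∑_μ S_μ π(x(μ))` is a representation of the
product system. Two facts carry this. The range projections of the finitely many paths of degree `p`
add up to `1`, hence are mutually orthogonal (`Family.star_S_mul_S`), which gives the inner products.
The relation `U_g S_μ = S_{g · μ} U_{g|_μ}` says that `π(a) S_ν = ∑_μ S_μ π(a_{μν})`, where `a_{μν}`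
are the matrix coefficients of the left action (`Family.coeffHom_mul_S`); this gives compatibility
with the left action and the multiplication. Since the elements `χ_μ` are a finite frame of `X_p`,
the homomorphism `ψ_p^{(1)}` has the explicit formula `T ↦ ∑_{μ,ν} S_μ π(⟨χ_μ, T χ_ν⟩) S_ν*`
(`Family.operatorHom`), and covariance amounts to `∑_μ S_μ S_μ* = 1`.

Conversely, for a covariant representation `ψ`, the elements `ψ_0(j(g))` and `ψ(χ_μ)` satisfy the
relations of `O_{G,Λ}` (`Representation.family`): the Cuntz–Krieger relation is covariance for
`j(δ_v)`, which acts on `X_p` as `∑_{μ ∈ vΛ^p} Θ_{χ_μ,χ_μ}`. The Cuntz–Pimsner algebra is defined as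
a not necessarily unital subalgebra of a universal unital algebra; it is unital with unit `ψ_0(1)`,
which need not be the unit of the larger algebra, and the lift from `O_{G,Λ}` takes values in it.
-/

open RightHilbertModule HigherRankGraph

noncomputable section

/-! ### Unital C*-algebras and orthogonal projections -/

/-- The unital C*-algebra structure on a C*-algebra `B` in which `e` is a two-sided unit. -/
abbrev NonUnitalCStarAlgebra.toCStarAlgebra {B : Type*} [NonUnitalCStarAlgebra B] (e : B)
    (he : ∀ b, e * b = b) (he' : ∀ b, b * e = b) : CStarAlgebra B :=
  let r : NormedRing B :=
    { ‹NonUnitalCStarAlgebra B› with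
      one := e
      one_mul := he
      mul_one := he' }
  { r, ‹NonUnitalCStarAlgebra B› with
    algebraMap :=
      { toFun := fun c => c • e
        map_one' := one_smul ℂ e
        map_mul' := fun a b => by rw [smul_mul_assoc, he, smul_smul]
        map_zero' := zero_smul ℂ e
        map_add' := fun a b => add_smul a b e }
    commutes' := fun c x => by
      change (c • e) * x = x * (c • e)
      rw [smul_mul_assoc, mul_smul_comm, he, he']
    smul_def' := fun c x => by
      change c • x = (c • e) * x
      rw [smul_mul_assoc, he]
    norm_smul_le := fun c x => norm_smul_le c x }

/-- If the projections `p i` of a C*-algebra add up to `1`, then they are mutually orthogonal. -/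
lemma IsStarProjection.mul_eq_zero_of_sum_eq_one {B ι : Type*} [CStarAlgebra B] [Fintype ι]
    {p : ι → B} (hp : ∀ i, IsStarProjection (p i)) (hsum : ∑ i, p i = 1) {i j : ι} (hij : i ≠ j) :
    p i * p j = 0 := by
  classical
  let _ : PartialOrder B := CStarAlgebra.spectralOrder _
  have : StarOrderedRing B := CStarAlgebra.spectralOrderedRing _
  have hstar : ∀ k, star (p k * p j) * (p k * p j) = p j * p k * p j := fun k => by
    rw [star_mul, (hp k).isSelfAdjoint.star_eq, (hp j).isSelfAdjoint.star_eq, mul_assoc,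
      ← mul_assoc (p k), (hp k).isIdempotentElem.eq, mul_assoc]
  have htot : ∑ k, star (p k * p j) * (p k * p j) = p j := by
    simp only [hstar]
    rw [← Finset.sum_mul, ← Finset.mul_sum, hsum, mul_one, (hp j).isIdempotentElem.eq]
  -- The summand for `k = j` is already the whole sum, so the other ones, being positive, vanish.
  have hj : star (p j * p j) * (p j * p j) = p j := by
    rw [hstar, (hp j).isIdempotentElem.eq, (hp j).isIdempotentElem.eq]
  rw [← Finset.add_sum_erase _ _ (Finset.mem_univ j), hj, add_eq_left,
    Finset.sum_eq_zero_iff_of_nonneg fun k _ => star_mul_self_nonneg _] at htot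
  exact CStarRing.star_mul_self_eq_zero_iff _ |>.mp
    (htot i (Finset.mem_erase.mpr ⟨hij, Finset.mem_univ i⟩))

/-! ### The universal representation of a product system -/

namespace ProductSystem

variable {P : Type} [AddCommMonoid P] {A : Type u} [CStarAlgebra A] (X : ProductSystem P A)

instance : IsClosed (X.cuntzPimsnerAlgebra : Set X.cpRelations.Universal) :=
  NonUnitalStarSubalgebra.isClosed_topologicalClosure _

/-- The generator of the Cuntz–Pimsner algebra which belongs to `x ∈ X_p`. -/
def cpGen (p : P) (x : X.fiber p) : X.CuntzPimsnerAlgebra :=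
  ⟨X.cpRelations.gen ⟨p, x⟩, NonUnitalStarSubalgebra.le_topologicalClosure _
    (NonUnitalStarAlgebra.subset_adjoin ℂ _ ⟨_, rfl⟩)⟩

lemma coord_cpGen (N : X.cpRelations.Seminorms) (p : P) (x : X.fiber p) :
    X.cpRelations.coord N (X.cpGen p x).1 = (X.cpRelations.model N).gen ⟨p, x⟩ := rfl

variable {X} in
lemma ext_cpCoord {x y : X.CuntzPimsnerAlgebra}
    (h : ∀ N, X.cpRelations.coord N x.1 = X.cpRelations.coord N y.1) : x = y :=
  Subtype.ext (CStarRelations.ext_coord h)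

/-- The Cuntz–Pimsner algebra is topologically generated by the elements of the product system. -/
lemma cpAlgebra_induction {p : X.CuntzPimsnerAlgebra → Prop} (hc : IsClosed {a | p a})
    (hgen : ∀ n x, p (X.cpGen n x)) (hadd : ∀ a b, p a → p b → p (a + b)) (h0 : p 0)
    (hmul : ∀ a b, p a → p b → p (a * b)) (hsmul : ∀ (c : ℂ) a, p a → p (c • a))
    (hstar : ∀ a, p a → p (star a)) (a : X.CuntzPimsnerAlgebra) : p a := by
  have key : ∀ (y : X.cpRelations.Universal)
      (hy : y ∈ NonUnitalStarAlgebra.adjoin ℂ (Set.range X.cpRelations.gen)),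
      p ⟨y, NonUnitalStarSubalgebra.le_topologicalClosure _ hy⟩ := by
    intro y hy
    induction hy using NonUnitalStarAlgebra.adjoin_induction with
    | mem x hx => obtain ⟨⟨n, x⟩, rfl⟩ := hx; exact hgen n x
    | add x y hx hy h1 h2 => exact hadd _ _ h1 h2
    | zero => exact h0
    | mul x y hx hy h1 h2 => exact hmul _ _ h1 h2
    | smul c x hx h1 => exact hsmul c _ h1
    | star x hx h1 => exact hstar _ h1
  obtain ⟨y, hy, hlim⟩ := mem_closure_iff_seq_limit.mp
    (show a.1 ∈ closure (NonUnitalStarAlgebra.adjoin ℂ (Set.range X.cpRelations.gen) :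
      Set X.cpRelations.Universal) from a.2)
  exact hc.mem_of_tendsto (f := fun n => (⟨y n, NonUnitalStarSubalgebra.le_topologicalClosure _
    (hy n)⟩ : X.CuntzPimsnerAlgebra)) (b := Filter.atTop) (tendsto_subtype_rng.mpr hlim)
    (Filter.Eventually.of_forall fun n => key _ (hy n))

/-- The universal representation of `X`, with values in the Cuntz–Pimsner algebra. -/
def cpRepresentation : X.Representation X.CuntzPimsnerAlgebra where
  toMap p :=
    { toFun := X.cpGen p
      map_add' := fun x y => ext_cpCoord fun N => by
        obtain ⟨ψ, -, hψ⟩ := (X.cpRelations.model N).rel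
        change _ = X.cpRelations.coord N ((X.cpGen p x).1 + (X.cpGen p y).1)
        simp only [map_add, coord_cpGen, hψ]
      map_smul' := fun c x => ext_cpCoord fun N => by
        obtain ⟨ψ, -, hψ⟩ := (X.cpRelations.model N).rel
        change _ = X.cpRelations.coord N (c • (X.cpGen p x).1)
        simp only [map_smul, coord_cpGen, hψ] }
  coeff :=
    { toFun := fun a => X.cpGen 0 (X.unit a)
      map_smul' := fun c a => ext_cpCoord fun N => by
        obtain ⟨ψ, -, hψ⟩ := (X.cpRelations.model N).rel
        change _ = X.cpRelations.coord N (c • (X.cpGen 0 (X.unit a)).1)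
        simp only [map_smul, coord_cpGen, hψ]
      map_zero' := ext_cpCoord fun N => by
        obtain ⟨ψ, -, hψ⟩ := (X.cpRelations.model N).rel
        change _ = X.cpRelations.coord N 0
        simp only [map_zero, coord_cpGen, hψ]
      map_add' := fun a b => ext_cpCoord fun N => by
        obtain ⟨ψ, -, hψ⟩ := (X.cpRelations.model N).rel
        change _ = X.cpRelations.coord N ((X.cpGen 0 (X.unit a)).1 + (X.cpGen 0 (X.unit b)).1)
        simp only [map_add, coord_cpGen, hψ]
      map_mul' := fun a b => ext_cpCoord fun N => by
        obtain ⟨ψ, -, hψ⟩ := (X.cpRelations.model N).rel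
        change _ = X.cpRelations.coord N ((X.cpGen 0 (X.unit a)).1 * (X.cpGen 0 (X.unit b)).1)
        simp only [map_mul, coord_cpGen, hψ, ← ψ.coeff_apply]
      map_star' := fun a => ext_cpCoord fun N => by
        obtain ⟨ψ, -, hψ⟩ := (X.cpRelations.model N).rel
        change _ = X.cpRelations.coord N (star (X.cpGen 0 (X.unit a)).1)
        simp only [map_star, coord_cpGen, hψ, ← ψ.coeff_apply] }
  coeff_apply _ := rfl
  map_leftAct p a x := ext_cpCoord fun N => by
    obtain ⟨ψ, -, hψ⟩ := (X.cpRelations.model N).rel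
    change X.cpRelations.coord N (X.cpGen p _).1 =
      X.cpRelations.coord N ((X.cpGen 0 (X.unit a)).1 * (X.cpGen p x).1)
    simp only [map_mul, coord_cpGen, hψ, ← ψ.coeff_apply, ψ.map_leftAct]
  star_mul_map p x y := ext_cpCoord fun N => by
    obtain ⟨ψ, -, hψ⟩ := (X.cpRelations.model N).rel
    change X.cpRelations.coord N (star (X.cpGen p x).1 * (X.cpGen p y).1) =
      X.cpRelations.coord N (X.cpGen 0 (X.unit (ip x y))).1
    simp only [map_mul, map_star, coord_cpGen, hψ, ← ψ.coeff_apply, ψ.star_mul_map]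
  map_mul {p q r} h x y := ext_cpCoord fun N => by
    obtain ⟨ψ, -, hψ⟩ := (X.cpRelations.model N).rel
    change X.cpRelations.coord N (X.cpGen r _).1 =
      X.cpRelations.coord N ((X.cpGen p x).1 * (X.cpGen q y).1)
    simp only [map_mul, coord_cpGen, hψ, ψ.map_mul h]

variable {X} in
/-- If `a` acts on `X_p` by a finite sum of rank-one operators, then every covariant representation
satisfies the corresponding identity. -/
lemma Representation.CPCovariant.coeff_eq_sum {B : Type*} [NonUnitalCStarAlgebra B]
    {ψ : X.Representation B} (hψ : ψ.CPCovariant) {ι : Type*} (s : Finset ι) {p : P} {a : A}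
    (x y : ι → X.fiber p) (h : X.leftAct p a = ∑ i ∈ s, theta (x i) (y i)) :
    ψ.coeff a = ∑ i ∈ s, ψ.toMap p (x i) * star (ψ.toMap p (y i)) := by
  obtain ⟨Ψ, hΨ, hcov⟩ := hψ p
  have : (⟨X.leftAct p a, X.leftAct_compact p a⟩ : compacts A (X.fiber p)) =
      ∑ i ∈ s, rankOne (x i) (y i) := by
    apply Subtype.ext
    rw [AddSubmonoidClass.coe_finsetSum]
    exact h
  rw [hcov, this, map_sum]
  exact Finset.sum_congr rfl fun i _ => hΨ _ _

/-- The universal representation inherits the covariance relation for finite sums of rank-one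
operators. -/
lemma cpRepresentation_coeff_eq_sum {ι : Type*} (s : Finset ι) {p : P} {a : A}
    (x y : ι → X.fiber p) (h : X.leftAct p a = ∑ i ∈ s, theta (x i) (y i)) :
    X.cpRepresentation.coeff a =
      ∑ i ∈ s, X.cpRepresentation.toMap p (x i) * star (X.cpRepresentation.toMap p (y i)) :=
  ext_cpCoord fun N => by
    obtain ⟨ψ, hcov, hψ⟩ := (X.cpRelations.model N).rel
    rw [AddSubmonoidClass.coe_finsetSum, map_sum]
    change X.cpRelations.coord N (X.cpGen 0 (X.unit a)).1 =
      ∑ i ∈ s, X.cpRelations.coord N ((X.cpGen p (x i)).1 * star (X.cpGen p (y i)).1)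
    simp only [map_mul, map_star, coord_cpGen, hψ, ← ψ.coeff_apply, hcov.coeff_eq_sum s x y h]

end ProductSystem

/-! ### From the relations of `O_{G,Λ}` to covariant representations -/

namespace SelfSimilar

section

variable {P : Type} [AddCommMonoid P] {G Λ : Type u} [Group G] [HigherRankGraph P Λ]
  [SelfSimilarAction G Λ] [Finite (Vertex Λ)] [RowFinite Λ] {n : P}

lemma finsum_paths {B : Type*} [AddCommMonoid B] (f : Λ → B) (v : Vertex Λ) (n : P) :
    ∑ᶠ μ ∈ {μ : Λ | rng μ = v.1 ∧ deg μ = n}, f μ =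
      ∑ μ : Path Λ n with rngV μ.1 = v, f μ.1 := by
  have h : {μ : Λ | rng μ = v.1 ∧ deg μ = n} =
      ((Finset.univ.filter fun μ : Path Λ n => rngV μ.1 = v).map
        (Function.Embedding.subtype _) : Finset Λ) := by
    ext μ
    simp only [Set.mem_ofPred_eq, Finset.coe_map, Set.mem_image, Finset.mem_coe,
      Finset.mem_filter, Finset.mem_univ, true_and]
    exact ⟨fun hμ => ⟨⟨μ, hμ.2⟩, Subtype.ext hμ.1, rfl⟩, fun ⟨ν, hν, hνμ⟩ =>
      ⟨hνμ ▸ congrArg Subtype.val hν, hνμ ▸ ν.2⟩⟩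
  rw [h, finsum_mem_coe_finset, Finset.sum_map]
  rfl

variable (G Λ) in
/-- A unitary representation of `G` and a Cuntz–Krieger `Λ`-family in `B` which satisfy the
relations of `O_{G,Λ}`. -/
structure Family (B : Type u) [CStarAlgebra B] where
  U : G →* unitary B
  S : Λ → B
  cuntzKrieger : IsCuntzKriegerFamily S
  sum_vertex : ∑ᶠ v : Vertex Λ, S v.1 = 1
  U_mul_S : ∀ g μ, (U g : B) * S μ = S (g • μ) * U (SelfSimilarAction.res g μ)

namespace Family

variable {B : Type u} [CStarAlgebra B] (F : Family G Λ B)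

lemma sum_vertex' : ∑ v : Vertex Λ, F.S v.1 = 1 := by
  rw [← F.sum_vertex, finsum_eq_sum_of_fintype]

lemma vertex_mul (v : Vertex Λ) (μ : Λ) : F.S v.1 * F.S μ = if rngV μ = v then F.S μ else 0 := by
  have h : F.S μ = F.S (rng μ) * F.S μ := by
    rw [← F.cuntzKrieger.mul _ _ (src_rng μ), id_comp]
  split_ifs with hv
  · rw [← hv]; exact h.symm
  · rw [h, ← mul_assoc]
    have := F.cuntzKrieger.orthogonal v (rngV μ) (Ne.symm hv)
    change F.S v.1 * F.S (rng μ) = 0 at this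
    rw [this, zero_mul]

lemma mul_src (μ : Λ) : F.S μ * F.S (src μ) = F.S μ := by
  rw [← F.cuntzKrieger.mul _ _ (rng_src μ).symm, comp_id]

lemma vertex_mul_vertex (v w : Vertex Λ) : F.S v.1 * F.S w.1 = if w = v then F.S w.1 else 0 := by
  have : rngV w.1 = w := Subtype.ext (rng_vertex w)
  rw [F.vertex_mul, this]

/-- The `*`-homomorphism `d ↦ ∑_v d(v) S_v` of `C(Λ^0)`. -/
def vertexHom : (Vertex Λ → ℂ) →⋆ₐ[ℂ] B where
  toFun d := ∑ v, d v • F.S v.1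
  map_one' := by simp only [Pi.one_apply, one_smul, F.sum_vertex']
  map_mul' d e := by
    simp only [Finset.sum_mul_sum, smul_mul_smul_comm, F.vertex_mul_vertex, smul_ite, smul_zero]
    refine Finset.sum_congr rfl fun v _ => ?_
    rw [Finset.sum_ite_eq' Finset.univ v, if_pos (Finset.mem_univ v), Pi.mul_apply]
  map_zero' := by simp
  map_add' d e := by simp [add_smul, Finset.sum_add_distrib]
  commutes' c := by
    simp only [Pi.algebraMap_apply, Algebra.algebraMap_self, RingHom.id_apply]
    rw [← Finset.smul_sum, F.sum_vertex', Algebra.algebraMap_eq_smul_one]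
  map_star' d := by
    rw [star_sum]
    refine Finset.sum_congr rfl fun v _ => ?_
    rw [star_smul, (F.cuntzKrieger.projection v).isSelfAdjoint.star_eq, Pi.star_apply]

lemma vertexHom_apply (d : Vertex Λ → ℂ) : F.vertexHom d = ∑ v, d v • F.S v.1 := rfl

lemma U_mul_vertexHom (g : G) (d : Vertex Λ → ℂ) :
    (F.U g : B) * F.vertexHom d = F.vertexHom (vertexAction G Λ g d) * F.U g := by
  rw [vertexHom_apply, vertexHom_apply, Finset.mul_sum, Finset.sum_mul]
  refine Fintype.sum_equiv (MulAction.toPerm g) _ _ fun v => ?_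
  rw [mul_smul_comm, smul_mul_assoc, F.U_mul_S, SelfSimilarAction.res_vertex]
  change _ = d (g⁻¹ • g • v) • _
  rw [inv_smul_smul]
  rfl

lemma crossed_holds : (crossedRelations (vertexAction G Λ)).holds B
    (Sum.elim F.vertexHom fun g => (F.U g : B)) :=
  ⟨F.vertexHom, F.U, fun _ => rfl, fun _ => rfl, fun g d => by
    rw [F.U_mul_vertexHom, mul_assoc, Unitary.mul_star_self_of_mem (F.U g).2, mul_one]⟩

/-- The integrated form of `U` and the vertex projections, on `A_{G,Λ} = C(Λ^0) ⋊ G`. -/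
def coeffHom : CoeffAlgebra G Λ →⋆ₐ[ℂ] B :=
  ((crossedRelations (vertexAction G Λ)).existsUnique_lift _ F.crossed_holds).choose

lemma coeffHom_incl (d : Vertex Λ → ℂ) :
    F.coeffHom (CrossedProduct.incl _ d) = F.vertexHom d :=
  ((crossedRelations (vertexAction G Λ)).existsUnique_lift _
    F.crossed_holds).choose_spec.1 (Sum.inl d)

lemma coeffHom_u (g : G) : F.coeffHom (u Λ g) = F.U g :=
  ((crossedRelations (vertexAction G Λ)).existsUnique_lift _
    F.crossed_holds).choose_spec.1 (Sum.inr g)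

lemma coeffHom_q (v : Vertex Λ) : F.coeffHom (q G v) = F.S v.1 := by
  rw [q, coeffHom_incl, vertexHom_apply, Finset.sum_eq_single v]
  · rw [Pi.single_eq_same, one_smul]
  · intro w _ hw
    rw [Pi.single_eq_of_ne hw, zero_smul]
  · simp

lemma continuous_coeffHom : Continuous F.coeffHom := by
  open scoped CStarAlgebra in exact map_continuous F.coeffHom

lemma S_mul_coeffHom (μ : Λ) (a : CoeffAlgebra G Λ) :
    F.S μ * F.coeffHom (q G (srcV μ) * a) = F.S μ * F.coeffHom a := by
  rw [map_mul, coeffHom_q, ← mul_assoc]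
  exact congrArg (· * _) (F.mul_src μ)

lemma S_mul_coeffHom_apply (x : Fiber G Λ n) (μ : Path Λ n) :
    F.S (src μ.1) * F.coeffHom (x μ) = F.coeffHom (x μ) := by
  conv_rhs => rw [← x.q_mul μ, map_mul, coeffHom_q]
  rfl

variable (n) in
lemma sum_mul_star : ∑ μ : Path Λ n, F.S μ.1 * star (F.S μ.1) = 1 := by
  rw [← F.sum_vertex', ← Finset.sum_fiberwise Finset.univ fun μ : Path Λ n => rngV μ.1]
  refine Finset.sum_congr rfl fun v _ => ?_
  rw [F.cuntzKrieger.sum v n, finsum_paths]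

lemma isStarProjection_mul_star (μ : Λ) : IsStarProjection (F.S μ * star (F.S μ)) :=
  ⟨by rw [IsIdempotentElem, ← mul_assoc, F.cuntzKrieger.partialIsometry], .mul_star_self _⟩

/-- Paths of the same degree give partial isometries with orthogonal ranges, since the range
projections of all paths of this degree add up to `1`. -/
lemma star_S_mul_S (μ ν : Path Λ n) :
    star (F.S μ.1) * F.S ν.1 = if μ = ν then F.S (src μ.1) else 0 := by
  split_ifs with h
  · rw [← h, F.cuntzKrieger.star_mul]
  · have h0 := IsStarProjection.mul_eq_zero_of_sum_eq_one
      (fun μ : Path Λ n => F.isStarProjection_mul_star μ.1) (F.sum_mul_star n) h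
    have hμ : star (F.S μ.1) * (F.S μ.1 * star (F.S μ.1)) = star (F.S μ.1) := by
      conv_rhs => rw [← F.cuntzKrieger.partialIsometry μ.1]
      simp only [star_mul, star_star]
    rw [← hμ, ← F.cuntzKrieger.partialIsometry ν.1]
    calc _ = star (F.S μ.1) * ((F.S μ.1 * star (F.S μ.1)) * (F.S ν.1 * star (F.S ν.1))) *
          F.S ν.1 := by
          simp only [mul_assoc]
      _ = 0 := by rw [h0, mul_zero, zero_mul]

/-- Elements of `A_{G,Λ}` move past the partial isometries according to the left action on the
product system. -/
lemma coeffHom_mul_S (a : CoeffAlgebra G Λ) (ν : Path Λ n) :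
    F.coeffHom a * F.S ν.1 = ∑ μ : Path Λ n, F.S μ.1 * F.coeffHom (coef a μ ν) := by
  refine CrossedProduct.induction_on (vertexAction G Λ)
    (p := fun a => F.coeffHom a * F.S ν.1 =
      ∑ μ : Path Λ n, F.S μ.1 * F.coeffHom (coef a μ ν)) ?_ ?_ ?_ ?_ a
  · exact isClosed_eq (F.continuous_coeffHom.mul continuous_const)
      (continuous_finsetSum _ fun μ _ => continuous_const.mul
        (F.continuous_coeffHom.comp (continuous_coef μ ν)))
  · simp [coef_zero]
  · intro a b ha hb
    simp only [map_add, add_mul, ha, hb, coef_add, mul_add, Finset.sum_add_distrib]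
  · intro d g
    rw [Finset.sum_eq_single (g • ν)]
    · rw [coef_incl_mul_u, if_pos rfl, map_smul, coeffHom_u, map_mul, coeffHom_incl]
      change F.vertexHom d * F.coeffHom (u Λ g) * _ = _
      rw [coeffHom_u, mul_assoc, F.U_mul_S, vertexHom_apply, Finset.sum_mul, mul_smul_comm]
      simp only [smul_mul_assoc, ← mul_assoc, vertex_mul, coe_smul, ite_mul, zero_mul, smul_ite,
        smul_zero]
      rw [Finset.sum_ite_eq, if_pos (Finset.mem_univ _)]
    · intro κ _ hκ
      rw [coef_incl_mul_u, if_neg hκ, map_zero, mul_zero]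
    · simp

variable (n) in
/-- The map `x ↦ ∑_μ S_μ x(μ)` on the fibre `X_{G,Λ,n}`. -/
def fiberMap : Fiber G Λ n →ₗ[ℂ] B where
  toFun x := ∑ μ : Path Λ n, F.S μ.1 * F.coeffHom (x μ)
  map_add' x y := by simp [mul_add, Finset.sum_add_distrib]
  map_smul' c x := by simp [Finset.smul_sum]

lemma fiberMap_apply (x : Fiber G Λ n) :
    F.fiberMap n x = ∑ μ : Path Λ n, F.S μ.1 * F.coeffHom (x μ) := rfl

lemma fiberMap_chi (μ : Path Λ n) : F.fiberMap n (chi μ : Fiber G Λ n) = F.S μ.1 := by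
  rw [fiberMap_apply, Finset.sum_eq_single μ]
  · rw [chi_apply_self, coeffHom_q]
    exact F.mul_src μ.1
  · intro ν _ h
    rw [chi_apply_of_ne h, map_zero, mul_zero]
  · simp

lemma fiberMap_unitEquiv (a : CoeffAlgebra G Λ) :
    F.fiberMap 0 (unitEquiv G Λ a) = F.coeffHom a := by
  rw [fiberMap_apply]
  calc _ = ∑ v : Vertex Λ, F.S v.1 * F.coeffHom a := by
        refine Finset.sum_congr rfl fun v _ => ?_
        rw [unitEquiv_apply, map_mul, coeffHom_q, ← mul_assoc,
          (F.cuntzKrieger.projection v).isIdempotentElem.eq]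
    _ = F.coeffHom a := by rw [← Finset.sum_mul, F.sum_vertex', one_mul]

lemma fiberMap_act (a : CoeffAlgebra G Λ) (x : Fiber G Λ n) :
    F.fiberMap n (act a x) = F.coeffHom a * F.fiberMap n x := by
  simp only [fiberMap_apply, act_apply, map_sum, map_mul, Finset.mul_sum, ← mul_assoc,
    coeffHom_mul_S, Finset.sum_mul]
  exact Finset.sum_comm

lemma star_fiberMap_mul (x y : Fiber G Λ n) :
    star (F.fiberMap n x) * F.fiberMap n y = F.coeffHom (ip x y) := by
  rw [fiberMap_apply, fiberMap_apply, ip_def, map_sum, star_sum, Finset.sum_mul_sum]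
  refine Finset.sum_congr rfl fun μ _ => ?_
  rw [Finset.sum_eq_single μ]
  · rw [star_mul, mul_assoc, ← mul_assoc (star (F.S μ.1)), star_S_mul_S, if_pos rfl,
      S_mul_coeffHom_apply, map_mul, map_star]
  · intro ν _ h
    rw [star_mul, mul_assoc, ← mul_assoc (star (F.S μ.1)), star_S_mul_S, if_neg h.symm, zero_mul,
      mul_zero]
  · simp

lemma fiberMap_mulFun {m n r : P} (h : m + n = r) (x : Fiber G Λ m) (y : Fiber G Λ n) :
    F.fiberMap r (mulFun h x y) = F.fiberMap m x * F.fiberMap n y := by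
  have hR : F.fiberMap m x * F.fiberMap n y =
      ∑ μ : Path Λ m, ∑ ν : Path Λ n, F.S μ.1 * (F.S ν.1 * F.coeffHom (act (x μ) y ν)) := by
    rw [fiberMap_apply F x, Finset.sum_mul]
    refine Finset.sum_congr rfl fun μ _ => ?_
    rw [mul_assoc, ← fiberMap_act, fiberMap_apply, Finset.mul_sum]
  rw [hR, fiberMap_apply, ← Finset.sum_product']
  -- Paths `λ` correspond to composable pairs `(μ, ν)`; for the other pairs `x(μ) · y` vanishes at `ν`.
  refine Finset.sum_of_injOn (fun lam => (head h lam, tail h lam)) ?_ ?_ ?_ ?_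
  · intro lam _ lam' _ he
    rw [← join_head_tail h lam, ← join_head_tail h lam']
    simp only [Prod.mk.injEq] at he
    congr 1
    · exact he.1
    · exact he.2
  · intro lam _
    simp
  · rintro ⟨μ, ν⟩ _ hnot
    by_cases hs : src μ.1 = rng ν.1
    · exact absurd ⟨join h μ ν hs, by simp, by simp [head_join, tail_join]⟩ hnot
    · rw [act_apply_eq_zero x y μ ν, map_zero, mul_zero, mul_zero]
      intro h'
      exact hs (congrArg Subtype.val h').symm
  · intro lam _
    rw [mulFun_apply, ← mul_assoc, ← F.cuntzKrieger.mul _ _ (src_head h lam)]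
    exact congrArg (F.S · * _) (congrArg Subtype.val (join_head_tail h lam)).symm

/-- The representation of the product system `X_{G,Λ}` given by a family. -/
def representation : (productSystem G Λ).Representation B where
  toMap p := F.fiberMap p
  coeff := F.coeffHom
  coeff_apply a := (F.fiberMap_unitEquiv a).symm
  map_leftAct _ a x := F.fiberMap_act a x
  star_mul_map _ x y := F.star_fiberMap_mul x y
  map_mul h x y := F.fiberMap_mulFun h x y

variable (n) in
/-- The homomorphism `T ↦ ∑_{μ,ν} S_μ ⟨χ_μ, T χ_ν⟩ S_ν*` of `L(X_{G,Λ,n})`. It is defined on all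
adjointable operators because the finitely many `χ_μ` form a (standard) frame of `X_{G,Λ,n}`. -/
def operatorHom : adjointable (CoeffAlgebra G Λ) (Fiber G Λ n) →⋆ₙₐ[ℂ] B where
  toFun T := ∑ μ : Path Λ n, ∑ ν : Path Λ n,
    F.S μ.1 * F.coeffHom (T.1 (chi ν) μ) * star (F.S ν.1)
  map_smul' c T := by
    simp only [Finset.smul_sum, MonoidHom.id_apply]
    refine Finset.sum_congr rfl fun μ _ => Finset.sum_congr rfl fun ν _ => ?_
    change F.S μ.1 * F.coeffHom (c • T.1 (chi ν) μ) * star (F.S ν.1) = _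
    rw [map_smul, mul_smul_comm, smul_mul_assoc]
  map_zero' := Finset.sum_eq_zero fun μ _ => Finset.sum_eq_zero fun ν _ => by
    change F.S μ.1 * F.coeffHom 0 * star (F.S ν.1) = _
    rw [map_zero, mul_zero, zero_mul]
  map_add' T T' := by
    simp only [← Finset.sum_add_distrib]
    refine Finset.sum_congr rfl fun μ _ => Finset.sum_congr rfl fun ν _ => ?_
    change F.S μ.1 * F.coeffHom (T.1 (chi ν) μ + T'.1 (chi ν) μ) * star (F.S ν.1) = _
    rw [map_add, mul_add, add_mul]
  map_mul' T T' := by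
    -- The entries `⟨χ_μ, T χ_ν⟩` multiply like matrices.
    have hentry : ∀ μ ν : Path Λ n, (T * T').1 (chi ν) μ =
        ∑ κ : Path Λ n, T.1 (chi κ) μ * T'.1 (chi ν) κ := fun μ ν => by
      change T.1 (T'.1 (chi ν)) μ = _
      rw [← ip_chi, ip_apply_right, ip_def]
      refine Finset.sum_congr rfl fun κ _ => ?_
      rw [← ip_chi κ, star_ip, ← ip_apply_right, ip_chi]
    simp only [hentry, Finset.sum_mul_sum]
    refine Finset.sum_congr rfl fun μ _ => ?_
    rw [Finset.sum_comm]
    have hterm : ∀ κ κ' ν : Path Λ n,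
        F.S μ.1 * F.coeffHom (T.1 (chi κ) μ) * star (F.S κ.1) *
          (F.S κ'.1 * F.coeffHom (T'.1 (chi ν) κ') * star (F.S ν.1)) =
        if κ = κ' then F.S μ.1 * F.coeffHom (T.1 (chi κ) μ * T'.1 (chi ν) κ) * star (F.S ν.1)
          else 0 := fun κ κ' ν => by
      have : F.S μ.1 * F.coeffHom (T.1 (chi κ) μ) * star (F.S κ.1) *
          (F.S κ'.1 * F.coeffHom (T'.1 (chi ν) κ') * star (F.S ν.1)) =
          F.S μ.1 * F.coeffHom (T.1 (chi κ) μ) * ((star (F.S κ.1) * F.S κ'.1) *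
            F.coeffHom (T'.1 (chi ν) κ')) * star (F.S ν.1) := by simp only [mul_assoc]
      rw [this, star_S_mul_S]
      split_ifs with h
      · subst h
        rw [S_mul_coeffHom_apply, map_mul]
        simp only [mul_assoc]
      · rw [zero_mul, mul_zero, zero_mul]
    simp only [hterm, map_sum, Finset.mul_sum, Finset.sum_mul]
    rw [Finset.sum_comm]
    refine Finset.sum_congr rfl fun κ _ => ?_
    rw [Finset.sum_comm]
    refine Finset.sum_congr rfl fun ν _ => ?_
    rw [Finset.sum_ite_eq, if_pos (Finset.mem_univ κ)]
  map_star' T := by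
    simp only [star_sum]
    rw [Finset.sum_comm]
    refine Finset.sum_congr rfl fun μ _ => Finset.sum_congr rfl fun ν _ => ?_
    have : (star T).1 (chi μ) ν = star (T.1 (chi ν) μ) := by
      rw [← ip_chi, ← ip_apply_left, ← star_ip, ip_chi]
    rw [this, star_mul, star_mul, star_star, map_star, mul_assoc]

lemma operatorHom_apply (T : adjointable (CoeffAlgebra G Λ) (Fiber G Λ n)) :
    F.operatorHom n T = ∑ ν : Path Λ n, F.fiberMap n (T.1 (chi ν)) * star (F.S ν.1) := by
  simp only [fiberMap_apply, Finset.sum_mul]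
  exact Finset.sum_comm

lemma operatorHom_theta (x y : Fiber G Λ n) :
    F.operatorHom n (theta x y) = F.fiberMap n x * star (F.fiberMap n y) := by
  rw [fiberMap_apply, fiberMap_apply, star_sum, Finset.sum_mul_sum]
  refine Finset.sum_congr rfl fun μ _ => Finset.sum_congr rfl fun ν _ => ?_
  rw [theta_apply, Fiber.op_smul_apply, ← star_ip, ip_chi, map_mul, map_star, star_mul]
  simp only [mul_assoc]

lemma operatorHom_leftAct (a : CoeffAlgebra G Λ) :
    F.operatorHom n (leftAct G Λ n a) = F.coeffHom a := by
  rw [operatorHom_apply]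
  simp only [leftAct_apply, fiberMap_act, fiberMap_chi, mul_assoc]
  rw [← Finset.mul_sum, sum_mul_star, mul_one]

lemma cpCovariant_representation : F.representation.CPCovariant := fun p =>
  ⟨(F.operatorHom p).comp (NonUnitalStarSubalgebraClass.subtype (compacts _ _)),
    fun x y => F.operatorHom_theta x y, fun a => (F.operatorHom_leftAct a).symm⟩

end Family

/-! ### From covariant representations to the relations of `O_{G,Λ}` -/

lemma unitEquiv_q (v : Vertex Λ) : unitEquiv G Λ (q G v) = chi v := by
  apply Fiber.ext
  intro w
  rw [unitEquiv_apply]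
  by_cases h : w = v
  · subst h
    rw [chi_apply_self, q_mul_q_self]
    exact congrArg (q G) (Subtype.ext (src_vertex w)).symm
  · rw [chi_apply_of_ne h, q_mul_q_of_ne G h]

lemma chi_q (μ : Path Λ n) :
    MulOpposite.op (q G (srcV μ.1)) • (chi μ : Fiber G Λ n) = chi μ := by
  apply Fiber.ext
  intro κ
  rw [op_smul_chi_apply]
  split_ifs with h
  · rw [h, chi_apply_self, q_mul_q_self]
  · rw [chi_apply_of_ne h]

lemma ip_chi_chi (μ : Path Λ n) :
    ip (A := CoeffAlgebra G Λ) (chi μ : Fiber G Λ n) (chi μ) = q G (srcV μ.1) := by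
  rw [ip_chi, chi_apply_self]

lemma act_u_chi (g : G) (μ : Path Λ n) :
    act (u Λ g) (chi μ : Fiber G Λ n) =
      MulOpposite.op (u Λ (SelfSimilarAction.res g μ.1)) • chi (g • μ) := by
  simpa only [MulOpposite.op_one, one_smul, mul_one] using leftAct_u_chi g μ 1

lemma mulFun_chi {m n r : P} (h : m + n = r) (μ : Path Λ m) (ν : Path Λ n)
    (hs : src μ.1 = rng ν.1) :
    mulFun h (chi μ : Fiber G Λ m) (chi ν) = chi (join h μ ν hs) := by
  have := mulFun_chi_chi (G := G) h μ ν 1 1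
  simp only [u_one, MulOpposite.op_one, one_smul, SelfSimilarAction.res_one, mul_one] at this
  rw [this]
  have hs' : src μ.1 = rng ((1 : G) • ν).1 := by rwa [one_smul]
  exact dif_pos hs'

/-- The projection `j(δ_v)` acts as the finite sum of rank-one operators
`∑_{μ ∈ vΛ^n} Θ_{χ_μ,χ_μ}`. -/
lemma leftAct_q (v : Vertex Λ) (n : P) :
    leftAct G Λ n (q G v) = ∑ μ : Path Λ n with rngV μ.1 = v, theta (chi μ) (chi μ) := by
  apply Subtype.ext
  ext1 x
  rw [AddSubmonoidClass.coe_finsetSum, LinearMap.sum_apply, leftAct_apply]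
  simp only [theta_apply, ip_chi]
  apply Fiber.ext
  intro κ
  rw [act_q, Fiber.sum_apply, Finset.sum_filter]
  simp only [op_smul_chi_apply]
  rw [Finset.sum_eq_single κ]
  · rw [if_pos rfl, x.q_mul]
  · intro ν _ hν
    rw [if_neg hν.symm, ite_self]
  · simp

namespace Representation

section

variable {B : Type u} [NonUnitalCStarAlgebra B] (ψ : (productSystem G Λ).Representation B)

lemma map_op_smul (x : Fiber G Λ n) (a : CoeffAlgebra G Λ) :
    ψ.toMap n (MulOpposite.op a • x) = ψ.toMap n x * ψ.coeff a := by
  have h := ψ.map_mul (add_zero n) x (unitEquiv G Λ a)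
  have h' := (productSystem G Λ).mul_unit x a
  rw [ψ.coeff_apply]
  exact (congrArg (ψ.toMap n) h').symm.trans h

lemma coeff_one_mul (x : Fiber G Λ n) : ψ.coeff 1 * ψ.toMap n x = ψ.toMap n x :=
  (ψ.map_leftAct n 1 x).symm.trans (congrArg (ψ.toMap n) (act_one x))

lemma mul_coeff_one (x : Fiber G Λ n) : ψ.toMap n x * ψ.coeff 1 = ψ.toMap n x := by
  rw [← map_op_smul, MulOpposite.op_one, one_smul]

lemma toMap_eq_sum (x : Fiber G Λ n) :
    ψ.toMap n x = ∑ μ : Path Λ n, ψ.toMap n (chi μ : Fiber G Λ n) * ψ.coeff (x μ) := by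
  refine (congrArg (ψ.toMap n) (sum_chi x).symm).trans ((map_sum (ψ.toMap n) _ _).trans ?_)
  exact Finset.sum_congr rfl fun μ _ => map_op_smul ψ _ _

end

variable {B : Type u} [CStarAlgebra B] (ψ : (productSystem G Λ).Representation B)

/-- The elements `ψ(χ_μ)`. -/
def path (μ : Λ) : B := ψ.toMap (deg μ) (chi ⟨μ, rfl⟩ : Fiber G Λ (deg μ))

lemma path_coe (μ : Path Λ n) : path ψ μ.1 = ψ.toMap n (chi μ : Fiber G Λ n) := by
  obtain ⟨μ, rfl⟩ := μ
  rfl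

lemma path_vertex (v : Vertex Λ) : path ψ v.1 = ψ.coeff (q G v) := by
  rw [path_coe, ψ.coeff_apply, ← unitEquiv_q]
  rfl

lemma star_path_mul (μ : Λ) : star (path ψ μ) * path ψ μ = ψ.coeff (q G (srcV μ)) :=
  (ψ.star_mul_map (deg μ) (chi ⟨μ, rfl⟩ : Fiber G Λ (deg μ)) (chi ⟨μ, rfl⟩)).trans
    (congrArg ψ.coeff (ip_chi_chi _))

lemma path_mul_q (μ : Λ) : path ψ μ * ψ.coeff (q G (srcV μ)) = path ψ μ := by
  rw [path, ← map_op_smul]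
  exact congrArg (ψ.toMap (deg μ)) (chi_q (⟨μ, rfl⟩ : Path Λ (deg μ)))

lemma isCuntzKriegerFamily_path
    (hq : ∀ (v : Vertex Λ) (n : P), ψ.coeff (q G v) = ∑ μ : Path Λ n with rngV μ.1 = v,
      ψ.toMap n (chi μ : Fiber G Λ n) * star (ψ.toMap n (chi μ : Fiber G Λ n))) :
    IsCuntzKriegerFamily (path ψ) where
  partialIsometry μ := by rw [mul_assoc, star_path_mul, path_mul_q]
  projection v := by
    rw [path_vertex]
    exact ⟨by rw [IsIdempotentElem, ← map_mul, q_mul_q_self],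
      by rw [IsSelfAdjoint, ← map_star, star_q]⟩
  orthogonal v w h := by rw [path_vertex, path_vertex, ← map_mul, q_mul_q_of_ne G h, map_zero]
  mul μ ν h := by
    have h1 := ψ.map_mul rfl (chi ⟨μ, rfl⟩ : Fiber G Λ (deg μ)) (chi ⟨ν, rfl⟩ : Fiber G Λ (deg ν))
    refine Eq.trans ?_ h1
    refine (path_coe ψ (join rfl ⟨μ, rfl⟩ ⟨ν, rfl⟩ h)).trans ?_
    exact congrArg (ψ.toMap _) (mulFun_chi rfl _ _ h).symm
  star_mul μ := by rw [star_path_mul, ← path_vertex]; rfl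
  sum v n := by
    rw [finsum_paths, path_vertex, hq v n]
    refine Finset.sum_congr rfl fun μ _ => ?_
    rw [path_coe]

/-- A representation of the product system with `ψ_0(1) = 1`, covariant on the projections
`j(δ_v)`, gives a family with the relations of `O_{G,Λ}`. -/
def family (h1 : ψ.coeff 1 = 1)
    (hq : ∀ (v : Vertex Λ) (n : P), ψ.coeff (q G v) = ∑ μ : Path Λ n with rngV μ.1 = v,
      ψ.toMap n (chi μ : Fiber G Λ n) * star (ψ.toMap n (chi μ : Fiber G Λ n))) :
    Family G Λ B where
  U :=
    { toFun := fun g => ⟨ψ.coeff (u Λ g), by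
        rw [Unitary.mem_iff, ← map_star, star_u, ← map_mul, ← map_mul, ← u_mul, ← u_mul,
          inv_mul_cancel, mul_inv_cancel, u_one, h1]
        exact ⟨rfl, rfl⟩⟩
      map_one' := Subtype.ext (by change ψ.coeff (u Λ 1) = 1; rw [u_one, h1])
      map_mul' := fun g h => Subtype.ext (by
        change ψ.coeff (u Λ (g * h)) = ψ.coeff (u Λ g) * ψ.coeff (u Λ h)
        rw [u_mul, map_mul]) }
  S := path ψ
  cuntzKrieger := isCuntzKriegerFamily_path ψ hq
  sum_vertex := by
    rw [finsum_eq_sum_of_fintype]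
    simp only [path_vertex]
    rw [← map_sum, sum_q, h1]
  U_mul_S g μ := by
    change ψ.coeff (u Λ g) * path ψ μ = path ψ (g • μ) * ψ.coeff (u Λ _)
    refine (ψ.map_leftAct (deg μ) (u Λ g) (chi ⟨μ, rfl⟩ : Fiber G Λ (deg μ))).symm.trans ?_
    refine (congrArg (ψ.toMap _) (act_u_chi g (⟨μ, rfl⟩ : Path Λ (deg μ)))).trans ?_
    rw [map_op_smul, ← path_coe]
    rfl

end Representation

/-! ### The isomorphism -/

variable (G Λ)

/-- The element `ψ_0(1)` is a two-sided unit of the Cuntz–Pimsner algebra, since `A` is unital and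
acts unitally on all fibres. -/
lemma cp_coeff_one_mul_and_mul (b : (productSystem G Λ).CuntzPimsnerAlgebra) :
    (productSystem G Λ).cpRepresentation.coeff 1 * b = b ∧
      b * (productSystem G Λ).cpRepresentation.coeff 1 = b := by
  refine ProductSystem.cpAlgebra_induction _
    (p := fun b => (productSystem G Λ).cpRepresentation.coeff 1 * b = b ∧
      b * (productSystem G Λ).cpRepresentation.coeff 1 = b) ?_ ?_ ?_ ?_ ?_ ?_ ?_ b
  · exact (isClosed_eq (continuous_const.mul continuous_id) continuous_id).inter
      (isClosed_eq (continuous_id.mul continuous_const) continuous_id)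
  · exact fun n x => ⟨Representation.coeff_one_mul (productSystem G Λ).cpRepresentation x,
      Representation.mul_coeff_one (productSystem G Λ).cpRepresentation x⟩
  · exact fun a b ha hb => ⟨by rw [mul_add, ha.1, hb.1], by rw [add_mul, ha.2, hb.2]⟩
  · exact ⟨mul_zero _, zero_mul _⟩
  · exact fun a b ha hb => ⟨by rw [← mul_assoc, ha.1], by rw [mul_assoc, hb.2]⟩
  · exact fun c a ha => ⟨by rw [mul_smul_comm, ha.1], by rw [smul_mul_assoc, ha.2]⟩
  · intro a ha
    have he : star ((productSystem G Λ).cpRepresentation.coeff 1) =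
        (productSystem G Λ).cpRepresentation.coeff 1 := by rw [← map_star, star_one]
    constructor
    · conv_lhs => rw [← he, ← star_mul, ha.2]
    · conv_lhs => rw [← he, ← star_mul, ha.1]

/-- The Cuntz–Pimsner algebra as a unital C*-algebra. Its unit is `ψ_0(1)`, which is in
general not the unit of the universal unital algebra in which it is defined. As the type already has
the operations of a subalgebra, this is only a local instance; the common operations agree
definitionally. -/
abbrev cpCStarAlgebra : CStarAlgebra (productSystem G Λ).CuntzPimsnerAlgebra :=
  NonUnitalCStarAlgebra.toCStarAlgebra ((productSystem G Λ).cpRepresentation.coeff 1)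
    (fun b => (cp_coeff_one_mul_and_mul G Λ b).1) (fun b => (cp_coeff_one_mul_and_mul G Λ b).2)

attribute [local instance] cpCStarAlgebra

lemma cp_coeff_one : (productSystem G Λ).cpRepresentation.coeff 1 = 1 := rfl

/-- The family in the Cuntz–Pimsner algebra with `U_g = ψ_0(j(g))` and `S_μ = ψ(χ_μ)`, for the
universal representation `ψ`. -/
def cpFamily : Family G Λ (productSystem G Λ).CuntzPimsnerAlgebra :=
  Representation.family (productSystem G Λ).cpRepresentation (cp_coeff_one G Λ) fun v n =>
    (productSystem G Λ).cpRepresentation_coeff_eq_sum _ _ _ (leftAct_q v n)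

lemma cpFamily_S (μ : Path Λ n) :
    (cpFamily G Λ).S μ.1 = (productSystem G Λ).cpGen n (chi μ : Fiber G Λ n) :=
  Representation.path_coe _ μ

variable {G Λ} in
lemma Family.holds {B : Type u} [CStarAlgebra B] (F : Family G Λ B) :
    (selfSimilarRelations G Λ).holds B (Sum.elim (fun g => (F.U g : B)) F.S) :=
  ⟨F.U, F.S, fun _ => rfl, fun _ => rfl, F.cuntzKrieger, F.sum_vertex, F.U_mul_S⟩

/-- The canonical unitary representation of `G` in `O_{G,Λ}`. -/
def universalUnitary : G →* unitary (SelfSimilarAlgebra G Λ) where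
  toFun g := ⟨(selfSimilarRelations G Λ).gen (Sum.inl g), by
    rw [Unitary.mem_iff]
    constructor <;>
    · refine CStarRelations.ext_coord fun N => ?_
      obtain ⟨U, S, h1, -⟩ := ((selfSimilarRelations G Λ).model N).rel
      simp [h1, map_star]⟩
  map_one' := Subtype.ext <| CStarRelations.ext_coord fun N => by
    obtain ⟨U, S, h1, -⟩ := ((selfSimilarRelations G Λ).model N).rel
    simp [h1]
  map_mul' g h := Subtype.ext <| CStarRelations.ext_coord fun N => by
    obtain ⟨U, S, h1, -⟩ := ((selfSimilarRelations G Λ).model N).rel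
    simp [h1]

lemma isCuntzKriegerFamily_gen :
    IsCuntzKriegerFamily fun μ : Λ => (selfSimilarRelations G Λ).gen (Sum.inr μ) where
  partialIsometry μ := CStarRelations.ext_coord fun N => by
    obtain ⟨U, S, -, h2, h3, -⟩ := ((selfSimilarRelations G Λ).model N).rel
    simp only [map_mul, map_star, CStarRelations.coord_gen, h2, h3.partialIsometry]
  projection v :=
    ⟨CStarRelations.ext_coord fun N => by
      obtain ⟨U, S, -, h2, h3, -⟩ := ((selfSimilarRelations G Λ).model N).rel
      simp only [map_mul, CStarRelations.coord_gen, h2, (h3.projection v).isIdempotentElem.eq],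
    CStarRelations.ext_coord fun N => by
      obtain ⟨U, S, -, h2, h3, -⟩ := ((selfSimilarRelations G Λ).model N).rel
      simp only [map_star, CStarRelations.coord_gen, h2,
        (h3.projection v).isSelfAdjoint.star_eq]⟩
  orthogonal v w h := CStarRelations.ext_coord fun N => by
    obtain ⟨U, S, -, h2, h3, -⟩ := ((selfSimilarRelations G Λ).model N).rel
    simp only [map_mul, map_zero, CStarRelations.coord_gen, h2, h3.orthogonal v w h]
  mul μ ν h := CStarRelations.ext_coord fun N => by
    obtain ⟨U, S, -, h2, h3, -⟩ := ((selfSimilarRelations G Λ).model N).rel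
    simp only [map_mul, CStarRelations.coord_gen, h2, h3.mul μ ν h]
  star_mul μ := CStarRelations.ext_coord fun N => by
    obtain ⟨U, S, -, h2, h3, -⟩ := ((selfSimilarRelations G Λ).model N).rel
    simp only [map_mul, map_star, CStarRelations.coord_gen, h2, h3.star_mul]
  sum v n := CStarRelations.ext_coord fun N => by
    obtain ⟨U, S, -, h2, h3, -⟩ := ((selfSimilarRelations G Λ).model N).rel
    rw [finsum_paths]
    simp only [map_sum, map_mul, map_star, CStarRelations.coord_gen, h2]
    rw [h3.sum v n, finsum_paths]

lemma finsum_gen_vertex :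
    ∑ᶠ v : Vertex Λ, (selfSimilarRelations G Λ).gen (Sum.inr v.1) = 1 :=
  CStarRelations.ext_coord fun N => by
    obtain ⟨U, S, -, h2, -, h4, -⟩ := ((selfSimilarRelations G Λ).model N).rel
    rw [finsum_eq_sum_of_fintype] at h4 ⊢
    simp only [map_sum, map_one, CStarRelations.coord_gen, h2, h4]

lemma gen_mul_gen (g : G) (μ : Λ) :
    (selfSimilarRelations G Λ).gen (Sum.inl g) * (selfSimilarRelations G Λ).gen (Sum.inr μ) =
      (selfSimilarRelations G Λ).gen (Sum.inr (g • μ)) *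
        (selfSimilarRelations G Λ).gen (Sum.inl (SelfSimilarAction.res g μ)) :=
  CStarRelations.ext_coord fun N => by
    obtain ⟨U, S, h1, h2, -, -, h5⟩ := ((selfSimilarRelations G Λ).model N).rel
    simp only [map_mul, CStarRelations.coord_gen, h1, h2, h5]

/-- The generators of `O_{G,Λ}`. -/
def universalFamily : Family G Λ (SelfSimilarAlgebra G Λ) where
  U := universalUnitary G Λ
  S μ := (selfSimilarRelations G Λ).gen (Sum.inr μ)
  cuntzKrieger := isCuntzKriegerFamily_gen G Λ
  sum_vertex := finsum_gen_vertex G Λ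
  U_mul_S := gen_mul_gen G Λ

/-- The homomorphism `O_{G,Λ} → O_X` given by the family in `O_X`. -/
def toCuntzPimsner :
    SelfSimilarAlgebra G Λ →⋆ₐ[ℂ] (productSystem G Λ).CuntzPimsnerAlgebra :=
  ((selfSimilarRelations G Λ).existsUnique_lift _ (cpFamily G Λ).holds).choose

lemma toCuntzPimsner_gen (i : G ⊕ Λ) : toCuntzPimsner G Λ ((selfSimilarRelations G Λ).gen i) =
    Sum.elim (fun g => ((cpFamily G Λ).U g : (productSystem G Λ).CuntzPimsnerAlgebra))
      (cpFamily G Λ).S i :=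
  ((selfSimilarRelations G Λ).existsUnique_lift _ (cpFamily G Λ).holds).choose_spec.1 i

lemma cp_holds : (productSystem G Λ).cpRelations.holds (SelfSimilarAlgebra G Λ)
    fun px => (universalFamily G Λ).representation.toMap px.1 px.2 :=
  ⟨(universalFamily G Λ).representation, (universalFamily G Λ).cpCovariant_representation,
    fun _ _ => rfl⟩

/-- The homomorphism `O_X → O_{G,Λ}` given by the covariant representation of `X` in `O_{G,Λ}`. -/
def ofCuntzPimsner :
    (productSystem G Λ).CuntzPimsnerAlgebra →⋆ₙₐ[ℂ] SelfSimilarAlgebra G Λ :=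
  (((productSystem G Λ).cpRelations.existsUnique_lift _ (cp_holds G Λ)).choose :
    (productSystem G Λ).cpRelations.Universal →⋆ₙₐ[ℂ] SelfSimilarAlgebra G Λ).comp
    (NonUnitalStarSubalgebraClass.subtype (productSystem G Λ).cuntzPimsnerAlgebra)

lemma ofCuntzPimsner_cpGen (p : P) (x : Fiber G Λ p) :
    ofCuntzPimsner G Λ ((productSystem G Λ).cpGen p x) = (universalFamily G Λ).fiberMap p x :=
  ((productSystem G Λ).cpRelations.existsUnique_lift _ (cp_holds G Λ)).choose_spec.1 ⟨p, x⟩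

lemma continuous_toCuntzPimsner : Continuous (toCuntzPimsner G Λ) := by
  open scoped CStarAlgebra in exact map_continuous (toCuntzPimsner G Λ)

lemma continuous_ofCuntzPimsner : Continuous (ofCuntzPimsner G Λ) := by
  open scoped CStarAlgebra in exact map_continuous (ofCuntzPimsner G Λ)

lemma ofCuntzPimsner_coeff (a : CoeffAlgebra G Λ) :
    ofCuntzPimsner G Λ ((productSystem G Λ).cpRepresentation.coeff a) =
      (universalFamily G Λ).coeffHom a :=
  (ofCuntzPimsner_cpGen G Λ 0 (unitEquiv G Λ a)).trans ((universalFamily G Λ).fiberMap_unitEquiv a)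

lemma continuous_coeff : Continuous (productSystem G Λ).cpRepresentation.coeff := by
  open scoped CStarAlgebra in exact map_continuous (productSystem G Λ).cpRepresentation.coeff

lemma toCuntzPimsner_coeffHom (a : CoeffAlgebra G Λ) :
    toCuntzPimsner G Λ ((universalFamily G Λ).coeffHom a) =
      (productSystem G Λ).cpRepresentation.coeff a := by
  refine CrossedProduct.induction_on (vertexAction G Λ)
    (p := fun a => toCuntzPimsner G Λ ((universalFamily G Λ).coeffHom a) =
      (productSystem G Λ).cpRepresentation.coeff a) ?_ ?_ ?_ ?_ a
  · exact isClosed_eq ((continuous_toCuntzPimsner G Λ).comp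
      (universalFamily G Λ).continuous_coeffHom) (continuous_coeff G Λ)
  · simp only [map_zero]
  · intro a b ha hb
    simp only [map_add, ha, hb]
  · intro d g
    change toCuntzPimsner G Λ ((universalFamily G Λ).coeffHom
      (CrossedProduct.incl (vertexAction G Λ) d * u Λ g)) =
      (productSystem G Λ).cpRepresentation.coeff (CrossedProduct.incl (vertexAction G Λ) d * u Λ g)
    rw [map_mul, map_mul, map_mul, Family.coeffHom_u, incl_eq_sum]
    congr 1
    · simp only [map_sum, map_smul, Family.coeffHom_q]
      refine Finset.sum_congr rfl fun v _ => congrArg (d v • ·) ?_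
      exact (toCuntzPimsner_gen G Λ (Sum.inr v.1)).trans (Representation.path_vertex _ v)
    · exact toCuntzPimsner_gen G Λ (Sum.inl g)

lemma toCuntzPimsner_ofCuntzPimsner (b : (productSystem G Λ).CuntzPimsnerAlgebra) :
    toCuntzPimsner G Λ (ofCuntzPimsner G Λ b) = b := by
  refine ProductSystem.cpAlgebra_induction _
    (p := fun b => toCuntzPimsner G Λ (ofCuntzPimsner G Λ b) = b) ?_ ?_ ?_ ?_ ?_ ?_ ?_ b
  · exact isClosed_eq ((continuous_toCuntzPimsner G Λ).comp (continuous_ofCuntzPimsner G Λ))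
      continuous_id
  · intro p x
    refine (congrArg _ (ofCuntzPimsner_cpGen G Λ p x)).trans ?_
    refine (congrArg _ (Family.fiberMap_apply _ x)).trans ?_
    rw [map_sum]
    refine Eq.trans ?_ (Representation.toMap_eq_sum (productSystem G Λ).cpRepresentation x).symm
    refine Finset.sum_congr rfl fun μ _ => ?_
    rw [map_mul, toCuntzPimsner_coeffHom]
    exact congrArg (· * _) ((toCuntzPimsner_gen G Λ (Sum.inr μ.1)).trans (cpFamily_S G Λ μ))
  · exact fun a b ha hb => (congrArg _ (map_add _ a b)).trans
      ((map_add _ _ _).trans (congrArg₂ _ ha hb))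
  · exact (congrArg _ (map_zero (ofCuntzPimsner G Λ))).trans (map_zero _)
  · exact fun a b ha hb => (congrArg _ (map_mul _ a b)).trans
      ((map_mul _ _ _).trans (congrArg₂ _ ha hb))
  · exact fun c a ha => (congrArg _ (map_smul _ c a)).trans
      ((map_smul _ _ _).trans (congrArg _ ha))
  · exact fun a ha => (congrArg _ (map_star _ a)).trans
      ((map_star _ _).trans (congrArg _ ha))

lemma ofCuntzPimsner_toCuntzPimsner (b : SelfSimilarAlgebra G Λ) :
    ofCuntzPimsner G Λ (toCuntzPimsner G Λ b) = b := by
  let π : SelfSimilarAlgebra G Λ →⋆ₐ[ℂ] SelfSimilarAlgebra G Λ :=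
    { toFun := fun b => ofCuntzPimsner G Λ (toCuntzPimsner G Λ b)
      map_one' := by
        rw [map_one]
        exact (ofCuntzPimsner_coeff G Λ 1).trans (map_one _)
      map_mul' := fun a b => (congrArg _ (map_mul _ a b)).trans (map_mul _ _ _)
      map_zero' := (congrArg _ (map_zero _)).trans (map_zero _)
      map_add' := fun a b => (congrArg _ (map_add _ a b)).trans (map_add _ _ _)
      commutes' := fun c => by
        rw [Algebra.algebraMap_eq_smul_one, map_smul, map_one]
        refine (map_smul (ofCuntzPimsner G Λ) c _).trans (congrArg (c • ·) ?_)
        exact (ofCuntzPimsner_coeff G Λ 1).trans (map_one _)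
      map_star' := fun a => (congrArg _ (map_star _ a)).trans (map_star _ _) }
  have hπ : π = StarAlgHom.id ℂ _ := by
    refine ((selfSimilarRelations G Λ).existsUnique_lift _ (universalFamily G Λ).holds).unique ?_ ?_
    · rintro (g | μ)
      · refine (congrArg (ofCuntzPimsner G Λ) (toCuntzPimsner_gen G Λ (Sum.inl g))).trans ?_
        exact (ofCuntzPimsner_coeff G Λ (u Λ g)).trans ((universalFamily G Λ).coeffHom_u g)
      · refine (congrArg (ofCuntzPimsner G Λ) (toCuntzPimsner_gen G Λ (Sum.inr μ))).trans ?_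
        exact (ofCuntzPimsner_cpGen G Λ (deg μ) (chi ⟨μ, rfl⟩)).trans
          ((universalFamily G Λ).fiberMap_chi ⟨μ, rfl⟩)
    · rintro (g | μ) <;> rfl
  exact DFunLike.congr_fun hπ b

/-- The isomorphism of `O_X` with `O_{G,Λ}`. -/
def cuntzPimsnerEquiv :
    (productSystem G Λ).CuntzPimsnerAlgebra ≃⋆ₐ[ℂ] SelfSimilarAlgebra G Λ :=
  StarAlgEquiv.ofBijective (ofCuntzPimsner G Λ)
    ⟨Function.LeftInverse.injective (toCuntzPimsner_ofCuntzPimsner G Λ),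
      Function.RightInverse.surjective (ofCuntzPimsner_toCuntzPimsner G Λ)⟩

end

end SelfSimilar

end

/-- For every self-similar action of a countable group `G` on a row-finite `k`-graph `Λ` without
sources and with finitely many vertices (where `k = |I| ≥ 1`, possibly infinite), the Cuntz–Pimsner
algebra of the product system `X_{G,Λ}` is isomorphic to `O_{G,Λ}`. -/
theorem theoremT {I : Type} [Countable I] [Nonempty I] {G Λ : Type u} [Group G] [Countable G]
    [Countable Λ] [HigherRankGraph (I →₀ ℕ) Λ] [HigherRankGraph.RowFinite Λ]
    [HigherRankGraph.NoSources Λ] [Finite (HigherRankGraph.Vertex Λ)] [SelfSimilarAction G Λ] :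
    Nonempty ((SelfSimilar.productSystem G Λ).CuntzPimsnerAlgebra ≃⋆ₐ[ℂ]
      SelfSimilarAlgebra G Λ) := by
  exact ⟨SelfSimilar.cuntzPimsnerEquiv G Λ⟩
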